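/- **Theorem (shortest path reconfiguration on circular-arc graphs).** Let $G$ be a finite simple undirected graph and let $s,t$ be vertices of $G$. Two shortest $s$–$t$ paths $P,Q$ in $G$ are called *reconfigurable* if there is a finite sequence $P=P_0,P_1,\dots,P_k=Q$ ($k\ge 0$) of shortest $s$–$t$ paths in $G$ such that $P_i$ and $P_{i+1}$ differ in exactly one vertex for every $0\le i<k$. The shortest path reconfiguration problem (SPR) asks, given $(G,s,t,P,Q)$, whether $P$ and $Q$ are reconfigurable. A *circular-arc graph* is a graph that is the intersection graph of a family of arcs on a circle, that is, each vertex can be assigned an arc of the circle so that two distinct vertices are adjacent if and only if their arcs intersect. SPR can be solved in polynomial time on circular-arc graphs: there are a deterministic (multi-stack) Turing machine and a polynomial $p$ such that for every instance $(G,s,t,P,Q)$ in which $G$ is a circular-arc graph, given by the adjacency matrix of $G$, the vertices $s,t$ and the vertex sequences of the shortest $s$–$t$ paths $P,Q$ (no arc representation of $G$ is given), the machine halts within $p(N)$ steps, where $N$ is the length of the input word, and answers correctly whether $P$ and $Q$ are reconfigurable. -/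

import Mathlib

/-- An arc of the circle `ℝ / ℤ`: the image of a closed interval `[a, b]`, run through
counterclockwise from `a` to `b`.  Single points and the whole circle are allowed. -/
def IsCircleArc (A : Set (AddCircle (1 : ℝ))) : Prop :=
  ∃ a b : ℝ, a ≤ b ∧ A = (fun x : ℝ => (x : AddCircle (1 : ℝ))) '' Set.Icc a b

/-- A circular-arc graph: the intersection graph of a family of arcs on a circle. -/
def IsCircularArcGraph {V : Type*} (G : SimpleGraph V) : Prop :=
  ∃ arc : V → Set (AddCircle (1 : ℝ)), (∀ v, IsCircleArc (arc v)) ∧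
    ∀ u v, u ≠ v → (G.Adj u v ↔ (arc u ∩ arc v).Nonempty)

/-- The shortest `s`-`t` paths of `G`.  (A walk of minimum length is automatically a path.) -/
def ShortestPath {V : Type*} (G : SimpleGraph V) (s t : V) : Type _ :=
  {p : G.Walk s t // p.length = G.dist s t}

/-- One reconfiguration step: two shortest `s`-`t` paths that differ in exactly one vertex. -/
def ReconfStep {V : Type*} {G : SimpleGraph V} {s t : V} (P Q : ShortestPath G s t) : Prop :=
  ∃! i : ℕ, P.1.getVert i ≠ Q.1.getVert i

/-- Two shortest `s`-`t` paths are reconfigurable if a finite sequence of shortest `s`-`t` paths,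
consecutive ones differing in exactly one vertex, leads from the first to the second
(a path is reconfigurable to itself by the one-term sequence). -/
def Reconfigurable {V : Type*} {G : SimpleGraph V} {s t : V} (P Q : ShortestPath G s t) : Prop :=
  Relation.ReflTransGen ReconfStep P Q

/-- An instance `(G, s, t, P, Q)` of the shortest path reconfiguration problem, with
`G` a graph on the vertices `0, …, n - 1`. -/
structure SPRInstance where
  n : ℕ
  G : SimpleGraph (Fin n)
  s : Fin n
  t : Fin n
  P : ShortestPath G s t
  Q : ShortestPath G s t

namespace SPRInstance

/-- The yes-instances. -/
def IsYes (I : SPRInstance) : Prop := Reconfigurable I.P I.Q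

/-- The number `k` as the word `1 … 1 0` with `k` ones.  The alphabet `Option Bool` consists of
the two bits and a separator `none`. -/
def encodeNat (k : ℕ) : List (Option Bool) :=
  List.replicate k (some true) ++ [some false]

open Classical in
/-- The adjacency matrix, row after row, with a separator after each row. -/
noncomputable def encodeGraph {n : ℕ} (G : SimpleGraph (Fin n)) : List (Option Bool) :=
  (List.finRange n).flatMap fun u =>
    ((List.finRange n).map fun v => some (decide (G.Adj u v))) ++ [none]

/-- The vertices of a path in order, from `s` to `t`, followed by a separator. -/
def encodePath {n : ℕ} {G : SimpleGraph (Fin n)} {s t : Fin n} (P : ShortestPath G s t) :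
    List (Option Bool) :=
  (P.1.support.flatMap fun v : Fin n => encodeNat v.val) ++ [none]

/-- The input word of an instance.  Its length is at least `n ^ 2` and at most polynomial
in `n`. -/
noncomputable def encode (I : SPRInstance) : List (Option Bool) :=
  encodeNat I.n ++ encodeGraph I.G ++ encodeNat I.s ++ encodeNat I.t ++
    encodePath I.P ++ encodePath I.Q

end SPRInstance

open Classical in
/-- Shortest path reconfiguration restricted to the graph class `C` is solvable in polynomial
time: some (multi-stack) Turing machine, given the word of any instance whose graph
belongs to `C`, answers whether `P` and `Q` are reconfigurable, within a number of steps bounded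
by a fixed polynomial in the length of the input word. -/
def SPRPolyTimeOn (C : ∀ n : ℕ, SimpleGraph (Fin n) → Prop) : Prop :=
  Nonempty (Turing.TM2ComputableInPolyTime
    (fun I : {I : SPRInstance // C I.n I.G} => I.1.encode)
    Computability.encodeBool
    (fun I : {I : SPRInstance // C I.n I.G} => decide I.1.IsYes))

/-! ### A small language of stack programs and its compilation to Turing machines -/

/-! Let `d` be the distance from `s` to `t`, and say that two vertices meet if they are equal or
adjacent. The arcs serve only to prove correctness; the algorithm reads just the matrix and the
paths.

For `d ≥ 5`, two shortest paths are reconfigurable iff they meet at every position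
(`reconfigurable_iff_meets`). Consider the vertices of both paths at two or three consecutive
positions. If their arcs cover the circle, some vertex among them meets `s` and some vertex meets
`t`; these sit at positions at most 1 and at least `d - 1`, which is too far apart. So the arcs miss
a point, and cutting the circle there turns them into real intervals (`intervals_or_dominating`).
For intervals, meeting at positions `j` and `j + 2` forces meeting at `j + 1`
(`IsSeq.meets_between`), hence meeting a fixed path everywhere is invariant under reconfiguration
steps. Conversely, two paths that meet at consecutive positions span a four-cycle there, possibly
degenerate, which has a chord (`IsSeq.adj_or_adj`); these chords always allow some vertex of `P` to
be replaced by the vertex of `Q` at that position (`exists_swap`), and the number of differences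
drops.

For `d ≤ 4`, a shortest path is determined by its vertices at positions one to three, so a search
through the at most `n ^ 3` triples decides the question in every graph
(`reconfigurable_iff_triple`, `mem_found_iff`).

For the machine, structured programs on finitely many stacks are compiled to Turing machines whose
labels are the pending continuations (`polyTime_of_run`). Numbers are kept in unary, and the
functions computable in polynomial time are closed under sums over polynomially bounded ranges,
hence under products and bounded quantifiers. One further construction iterates the computation of a
Boolean table (`polyTime_of_comp`); the table is the set of triples found so far. -/

namespace StackProgram

open Turing Function

/-- The alphabet of the stk. -/
abbrev Sym := Option Bool

/-- The contents of the stk, which are indexed by the natural numbers. -/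
abbrev Store := ℕ → List Sym

/-- Structured programs acting on stk. Tests look at the top of a stack. -/
inductive Cmd
  | skip : Cmd
  | push (r : ℕ) (a : Sym) : Cmd
  | pop (r : ℕ) : Cmd
  | seq (c₁ c₂ : Cmd) : Cmd
  | ite (r : ℕ) (p : Option Sym → Bool) (c₁ c₂ : Cmd) : Cmd
  | loop (r : ℕ) (p : Option Sym → Bool) (c : Cmd) : Cmd

/-- `Run c S S' n`: the program `c`, started with the store `S`, ends with `S'` after `n` steps. -/
inductive Run : Cmd → Store → Store → ℕ → Prop
  | skip (S) : Run .skip S S 1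
  | push (r a S) : Run (.push r a) S (update S r (a :: S r)) 1
  | pop (r S) : Run (.pop r) S (update S r (S r).tail) 1
  | seq {c₁ c₂ S S' S'' m n} (h₁ : Run c₁ S S' m) (h₂ : Run c₂ S' S'' n) :
      Run (.seq c₁ c₂) S S'' (m + n + 1)
  | ite_true {r p c₁ c₂ S S' n} (h : p (S r).head? = true) (h₁ : Run c₁ S S' n) :
      Run (.ite r p c₁ c₂) S S' (n + 1)
  | ite_false {r p c₁ c₂ S S' n} (h : p (S r).head? = false) (h₂ : Run c₂ S S' n) :
      Run (.ite r p c₁ c₂) S S' (n + 1)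
  | loop_true {r p c S S' S'' m n} (h : p (S r).head? = true) (h₁ : Run c S S' m)
      (h₂ : Run (.loop r p c) S' S'' n) : Run (.loop r p c) S S'' (m + n + 1)
  | loop_false {r p c S} (h : p (S r).head? = false) : Run (.loop r p c) S S 1

namespace Cmd

/-- A strict upper bound for the registers that a program mentions. -/
def bound : Cmd → ℕ
  | skip => 1
  | push r _ => r + 1
  | pop r => r + 1
  | seq c₁ c₂ => max c₁.bound c₂.bound
  | ite r _ c₁ c₂ => max (r + 1) (max c₁.bound c₂.bound)
  | loop r _ c => max (r + 1) c.bound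

/-- The continuations that can occur while `c` is executed before the continuation `k`. -/
def conts : Cmd → List Cmd → Set (List Cmd)
  | c@skip, k => {c :: k, k}
  | c@(push _ _), k => {c :: k, k}
  | c@(pop _), k => {c :: k, k}
  | c@(seq c₁ c₂), k => {c :: k} ∪ conts c₁ (c₂ :: k) ∪ conts c₂ k
  | c@(ite _ _ c₁ c₂), k => {c :: k} ∪ conts c₁ k ∪ conts c₂ k
  | c@(loop _ _ c₁), k => {c :: k, k} ∪ conts c₁ (c :: k)

/-- The continuations become the labels of the machine, so they must be finitely many. A loop body
is followed by the loop itself, so repeated rounds create no new continuations. -/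
theorem finite_conts (c : Cmd) (k : List Cmd) : (c.conts k).Finite := by
  induction c generalizing k with
  | seq c₁ c₂ h₁ h₂ => exact ((Set.finite_singleton _).union (h₁ _)).union (h₂ _)
  | ite r p c₁ c₂ h₁ h₂ => exact ((Set.finite_singleton _).union (h₁ _)).union (h₂ _)
  | loop r p c h => exact ((Set.finite_singleton _).insert _).union (h _)
  | _ => exact (Set.finite_singleton _).insert _

theorem cons_mem_conts (c : Cmd) (k : List Cmd) : c :: k ∈ c.conts k := by
  cases c <;> simp [conts]

theorem mem_conts (c : Cmd) (k : List Cmd) : k ∈ c.conts k := by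
  induction c generalizing k with
  | seq c₁ c₂ h₁ h₂ => exact Or.inr (h₂ _)
  | ite r p c₁ c₂ h₁ h₂ => exact Or.inr (h₂ _)
  | _ => simp [conts]

/-! #### The Turing machine of a program -/

/-- The stack alphabets: the extra stack `none` is the output stack. -/
abbrev Alph (M : ℕ) (k : Option (Fin (M + 1))) : Type :=
  match k with
  | none => Bool
  | some _ => Sym

/-- The statement of the Turing machine that belongs to a continuation; `Λ` is the type of labels
and `g` gives the label of a continuation. The empty continuation writes the answer. -/
def stmt (M : ℕ) {Λ : Type} (g : List Cmd → Λ) :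
    List Cmd → TM2.Stmt (Alph M) Λ (Option Sym)
  | [] => .pop (some (Fin.ofNat (M + 1) 1)) (fun _ x => x)
      (.push none (fun v => (v == some (some true) : Bool)) (.load (fun _ => none) .halt))
  | skip :: k => .goto fun _ => g k
  | push r a :: k => .push (some (Fin.ofNat (M + 1) r)) (fun _ => a) (.goto fun _ => g k)
  | pop r :: k => .pop (some (Fin.ofNat (M + 1) r)) (fun v _ => v) (.goto fun _ => g k)
  | seq c₁ c₂ :: k => .goto fun _ => g (c₁ :: c₂ :: k)
  -- The internal register is cleared after each test, so that it is `none` whenever a continuation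
  -- starts.
  | ite r p c₁ c₂ :: k =>
      .peek (some (Fin.ofNat (M + 1) r)) (fun _ x => x)
        (.branch p (.load (fun _ => none) (.goto fun _ => g (c₁ :: k)))
          (.load (fun _ => none) (.goto fun _ => g (c₂ :: k))))
  | loop r p c :: k =>
      .peek (some (Fin.ofNat (M + 1) r)) (fun _ x => x)
        (.branch p (.load (fun _ => none) (.goto fun _ => g (c :: loop r p c :: k)))
          (.load (fun _ => none) (.goto fun _ => g k)))

/-- The labels of the machine of `c`. -/
abbrev Label (c : Cmd) : Type := {l : List Cmd // l ∈ c.conts []}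

open Classical in
/-- The label of a continuation. -/
noncomputable def label (c : Cmd) (l : List Cmd) : Label c :=
  if h : l ∈ c.conts [] then ⟨l, h⟩ else ⟨[], mem_conts c []⟩

/-- The Turing machine that executes the program `c`. -/
noncomputable def machine (c : Cmd) : FinTM2 :=
  letI : Fintype (Label c) := (finite_conts c []).fintype
  { K := Option (Fin (c.bound + 1))
    k₀ := some 0
    k₁ := none
    Γ := Alph c.bound
    Λ := Label c
    main := label c [c]
    σ := Option Sym
    initialState := none
    Γk₀Fin := inferInstanceAs (Fintype Sym)
    m := fun l => stmt c.bound (label c) l.1 }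

/-- The stk of the machine that correspond to a store. -/
def stk (M : ℕ) (S : Store) : ∀ k, List (Alph M k)
  | none => []
  | some i => S i.val

theorem stk_update {M r : ℕ} (hr : r < M + 1) (S : Store) (x : List Sym) :
    stk M (update S r x) = update (stk M S) (some (Fin.ofNat (M + 1) r)) x := by
  funext k
  cases k with
  | none => simp [stk]
  | some i =>
    by_cases h : i = Fin.ofNat (M + 1) r
    · subst h
      simp [stk, Nat.mod_eq_of_lt hr]
    · have : i.val ≠ r := by
        rintro rfl
        exact h (by ext; simp)
      rw [update_of_ne (by simpa using h)]
      simp [stk, this]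

theorem stk_ofNat {M r : ℕ} (hr : r < M + 1) (S : Store) :
    stk M S (some (Fin.ofNat (M + 1) r)) = S r := by
  simp [stk, Nat.mod_eq_of_lt hr]

/-- The configuration of the machine at the continuation `l` with the store `S`. -/
noncomputable def cfg (c : Cmd) (l : List Cmd) (S : Store) : (machine c).Cfg :=
  (⟨some (label c l), none, stk c.bound S⟩ : TM2.Cfg (Alph c.bound) (Label c) (Option Sym))

/-- The step function, iterated through `Option`. -/
noncomputable def steps (c : Cmd) (n : ℕ) (x : Option (machine c).Cfg) : Option (machine c).Cfg :=
  (flip bind (machine c).step)^[n] x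

theorem steps_add (c : Cmd) (m n : ℕ) (x : Option (machine c).Cfg) :
    steps c (m + n) x = steps c n (steps c m x) := by
  rw [add_comm]
  exact iterate_add_apply _ _ _ _

theorem steps_one (c : Cmd) (l : List Cmd) (hl : l ∈ c.conts []) (S : Store) :
    steps c 1 (some (cfg c l S)) =
      some (TM2.stepAux (stmt c.bound (label c) l) none (stk c.bound S)) := by
  have : (label c l).1 = l := by simp [label, hl]
  show some (TM2.stepAux (stmt c.bound (label c) (label c l).1) none (stk c.bound S)) = _
  rw [this]

theorem one_le_bound (c : Cmd) : 1 ≤ c.bound := by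
  induction c <;> (simp [bound]; try omega)

/-- Simulation by induction on the run. The inclusion of continuations ensures that the default
value of `label` is never reached, and the bound ensures that reduction modulo the number of stacks
does not identify registers. -/
theorem steps_of_run (c₀ : Cmd) {c : Cmd} {S S' : Store} {n : ℕ} (h : Run c S S' n) :
    ∀ k, c.conts k ⊆ c₀.conts [] → c.bound ≤ c₀.bound →
      steps c₀ n (some (cfg c₀ (c :: k) S)) = some (cfg c₀ k S') := by
  induction h with
  | skip S =>
    intro k hk _
    rw [steps_one _ _ (hk (cons_mem_conts _ _))]
    rfl
  | push r a S =>
    intro k hk hb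
    have hr : r < c₀.bound + 1 := by simp only [bound] at hb; omega
    rw [steps_one _ _ (hk (cons_mem_conts _ _)), cfg, stk_update hr]
    simp only [stmt, TM2.stepAux, stk_ofNat hr]
    rfl
  | pop r S =>
    intro k hk hb
    have hr : r < c₀.bound + 1 := by simp only [bound] at hb; omega
    rw [steps_one _ _ (hk (cons_mem_conts _ _)), cfg, stk_update hr]
    simp only [stmt, TM2.stepAux, stk_ofNat hr]
    rfl
  | @seq c₁ c₂ S S' S'' m n _ _ ih₁ ih₂ =>
    intro k hk hb
    simp only [bound, max_le_iff] at hb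
    rw [show m + n + 1 = 1 + m + n by omega, steps_add, steps_add,
      steps_one _ _ (hk (cons_mem_conts _ _))]
    refine Eq.trans ?_ (ih₂ k (fun x hx => hk (Or.inr hx)) hb.2)
    congr 1
    exact ih₁ (c₂ :: k) (fun x hx => hk (Or.inl (Or.inr hx))) hb.1
  | @ite_true r p c₁ c₂ S S' n h _ ih =>
    intro k hk hb
    simp only [bound, max_le_iff] at hb
    have hr : r < c₀.bound + 1 := by omega
    rw [show n + 1 = 1 + n by omega, steps_add, steps_one _ _ (hk (cons_mem_conts _ _))]
    simp only [stmt, TM2.stepAux, stk_ofNat hr, h, cond_true]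
    exact ih k (fun x hx => hk (Or.inl (Or.inr hx))) hb.2.1
  | @ite_false r p c₁ c₂ S S' n h _ ih =>
    intro k hk hb
    simp only [bound, max_le_iff] at hb
    have hr : r < c₀.bound + 1 := by omega
    rw [show n + 1 = 1 + n by omega, steps_add, steps_one _ _ (hk (cons_mem_conts _ _))]
    simp only [stmt, TM2.stepAux, stk_ofNat hr, h, cond_false]
    exact ih k (fun x hx => hk (Or.inr hx)) hb.2.2
  | @loop_true r p c S S' S'' m n h _ _ ih₁ ih₂ =>
    intro k hk hb
    have hb' := hb
    simp only [bound, max_le_iff] at hb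
    have hr : r < c₀.bound + 1 := by omega
    rw [show m + n + 1 = 1 + m + n by omega, steps_add, steps_add,
      steps_one _ _ (hk (cons_mem_conts _ _))]
    refine Eq.trans ?_ (ih₂ k hk hb')
    congr 1
    simp only [stmt, TM2.stepAux, stk_ofNat hr, h, cond_true]
    exact ih₁ (loop r p c :: k) (fun x hx => hk (Or.inr hx)) hb.2
  | @loop_false r p c S h =>
    intro k hk hb
    simp only [bound, max_le_iff] at hb
    have hr : r < c₀.bound + 1 := by omega
    rw [steps_one _ _ (hk (cons_mem_conts _ _))]
    simp only [stmt, TM2.stepAux, stk_ofNat hr, h, cond_false]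
    rfl

/-- A program that decides `f` within polynomially many steps yields a Turing machine. -/
theorem polyTime_of_run {α : Type} {ea : α → List Sym} {f : α → Bool} (c : Cmd)
    (p : Polynomial ℕ)
    (h : ∀ a, ∃ n ≤ p.eval (ea a).length,
      Run c (update (fun _ => []) 0 (ea a)) (update (fun _ => []) 1 [some (f a)]) n) :
    Nonempty (TM2ComputableInPolyTime ea Computability.encodeBool f) := by
  have key : ∀ a, ∃ n ≤ (p + 1).eval (ea a).length,
      steps c n (some (initList (machine c) (ea a))) = some (haltList (machine c) [f a]) := by
    intro a
    obtain ⟨n, hn, hrun⟩ := h a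
    -- The additional step belongs to the empty continuation, which writes the answer and halts.
    refine ⟨n + 1, by simpa using hn, ?_⟩
    have h₀ : initList (machine c) (ea a) = cfg c [c] (update (fun _ => []) 0 (ea a)) := by
      rw [cfg, stk_update (by omega)]
      unfold initList
      congr 1
      funext k
      rcases k with _ | i
      · rfl
      · by_cases hi : i = 0
        · subst hi
          rfl
        · rw [update_of_ne (by simpa using hi)]
          exact dif_neg (fun h => hi (Option.some.inj h))
    rw [steps_add, h₀, steps_of_run c hrun [] subset_rfl le_rfl,
      steps_one _ _ (mem_conts _ _)]
    have h1 : 1 < c.bound + 1 := by have := one_le_bound c; omega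
    simp only [stmt, TM2.stepAux, stk_ofNat h1, haltList]
    congr 2
    funext k
    rcases k with _ | i
    · refine Eq.trans ?_ (dif_pos rfl).symm
      rw [update_self none, ← stk_update h1]
      cases f a <;> rfl
    · refine Eq.trans ?_ (dif_neg (fun h => Option.some_ne_none i h)).symm
      rw [update_of_ne (by simp), ← stk_update h1]
      simp [stk]
      rfl
  choose n hn hs using key
  exact ⟨{
    tm := machine c
    inputAlphabet := Equiv.refl _
    outputAlphabet := Equiv.refl _
    time := p + 1
    outputsFun := fun a =>
      { steps := n a
        evals_in_steps := by
          refine Eq.trans ?_ (hs a)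
          exact congrArg (fun l => steps c (n a) (some (initList (machine c) l)))
            (List.map_id (ea a))
        steps_le_m := hn a } }⟩

end Cmd

open Turing Function

/-! ### Programs with upper bounds for their running time -/

/-- `Ex c S S' B`: the program `c` leads from `S` to `S'` within `B` steps. -/
def Ex (c : Cmd) (S S' : Store) (B : ℕ) : Prop := ∃ n ≤ B, Run c S S' n

namespace Ex

variable {c c₁ c₂ : Cmd} {S S' S'' : Store} {B B' r : ℕ} {p : Option Sym → Bool}

theorem mono (h : Ex c S S' B) (hB : B ≤ B') : Ex c S S' B' :=
  let ⟨n, hn, hr⟩ := h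
  ⟨n, hn.trans hB, hr⟩

theorem skip (S : Store) : Ex .skip S S 1 := ⟨1, le_rfl, .skip S⟩

theorem push (r : ℕ) (a : Sym) (S : Store) : Ex (.push r a) S (update S r (a :: S r)) 1 :=
  ⟨1, le_rfl, .push r a S⟩

theorem pop (r : ℕ) (S : Store) : Ex (.pop r) S (update S r (S r).tail) 1 :=
  ⟨1, le_rfl, .pop r S⟩

theorem seq (h₁ : Ex c₁ S S' B) (h₂ : Ex c₂ S' S'' B') :
    Ex (.seq c₁ c₂) S S'' (B + B' + 1) :=
  let ⟨_, hm, hr⟩ := h₁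
  let ⟨_, hn, hr'⟩ := h₂
  ⟨_, by omega, .seq hr hr'⟩

theorem ite_true (h : p (S r).head? = true) (h₁ : Ex c₁ S S' B) :
    Ex (.ite r p c₁ c₂) S S' (B + 1) :=
  let ⟨_, hm, hr⟩ := h₁
  ⟨_, by omega, .ite_true h hr⟩

theorem ite_false (h : p (S r).head? = false) (h₂ : Ex c₂ S S' B) :
    Ex (.ite r p c₁ c₂) S S' (B + 1) :=
  let ⟨_, hm, hr⟩ := h₂
  ⟨_, by omega, .ite_false h hr⟩

/-- The store after `k` rounds is prescribed in closed form as `st k`, so a loop is verified by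
checking a single round. -/
theorem loop (st : ℕ → Store) (m : ℕ) (h₁ : ∀ k < m, p (st k r).head? = true)
    (h₂ : ∀ k < m, Ex c (st k) (st (k + 1)) B) (h₃ : p (st m r).head? = false) :
    Ex (.loop r p c) (st 0) (st m) (m * (B + 1) + 1) := by
  induction m generalizing st with
  | zero => exact ⟨1, by omega, .loop_false h₃⟩
  | succ m ih =>
    obtain ⟨n, hn, hr⟩ := ih (fun k => st (k + 1)) (fun k hk => h₁ _ (by omega))
      (fun k hk => h₂ _ (by omega)) h₃
    obtain ⟨n', hn', hr'⟩ := h₂ 0 (by omega)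
    refine ⟨_, ?_, .loop_true (h₁ 0 (by omega)) hr' hr⟩
    rw [Nat.succ_mul]
    omega

end Ex

/-! ### Unary numbers and elementary stack routines -/

/-- The unary representation of a number. -/
def un (v : ℕ) : List Sym := List.replicate v (some true)

@[simp] theorem un_zero : un 0 = [] := rfl

theorem un_succ (v : ℕ) : un (v + 1) = some true :: un v := rfl

@[simp] theorem length_un (v : ℕ) : (un v).length = v := List.length_replicate

@[simp] theorem reverse_un (v : ℕ) : (un v).reverse = un v := List.reverse_replicate ..

@[simp] theorem un_append_un (v w : ℕ) : un v ++ un w = un (v + w) := by simp [un]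

theorem tail_un (v : ℕ) : (un v).tail = un (v - 1) := by simp [un]

theorem head_un {v : ℕ} (h : 0 < v) : (un v).head? = some (some true) := by
  obtain ⟨v, rfl⟩ := Nat.exists_eq_add_of_lt h
  simp [un, List.replicate_succ]

namespace Cmd

/-- Move the top of `a`, if there is one, to `b`. -/
def move (a b : ℕ) : Cmd :=
  ite a (· == some (some true)) (seq (push b (some true)) (pop a))
    (ite a (· == some (some false)) (seq (push b (some false)) (pop a))
      (ite a (· == some none) (seq (push b none) (pop a)) skip))

/-- Move the contents of `a` to `b`, in reverse order. -/
def drain (a b : ℕ) : Cmd := loop a Option.isSome (move a b)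

/-- Empty a stack. -/
def clear (a : ℕ) : Cmd := loop a Option.isSome (pop a)

/-- Move as many symbols from `a` to `b` as there are symbols on `c`, and empty `c`. -/
def seek (c a b : ℕ) : Cmd := loop c Option.isSome (seq (pop c) (move a b))

end Cmd

open Cmd

variable {S : Store} {a b c d : ℕ}

/-- A program can push only fixed symbols, so the top is identified by up to three tests; push, pop
and their composition cost three more steps. -/
theorem ex_move (hab : a ≠ b) :
    Ex (move a b) S (update (update S a (S a).tail) b (((S a).take 1).reverse ++ S b)) 6 := by
  have aux : ∀ s l, S a = s :: l → Ex (.seq (.push b s) (.pop a)) S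
      (update (update S a (S a).tail) b (((S a).take 1).reverse ++ S b)) 3 := by
    intro s l hl
    convert (Ex.push b s S).seq (Ex.pop a _) using 1
    rw [update_of_ne hab, update_comm hab]
    simp [hl]
  rcases hS : S a with _ | ⟨s, l⟩
  · refine Ex.mono (B := 4) (Ex.ite_false (by simp [hS]) (Ex.ite_false (by simp [hS])
      (Ex.ite_false (by simp [hS]) ?_))) (by omega)
    convert Ex.skip S using 1
    funext r
    simp only [update_apply]
    split_ifs <;> simp_all
  · rw [← hS]
    rcases s with _ | (_ | _)
    · exact (Ex.ite_false (by simp [hS]) (Ex.ite_false (by simp [hS])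
        (Ex.ite_true (by simp [hS]) (aux _ _ hS))))
    · exact Ex.mono (Ex.ite_false (by simp [hS]) (Ex.ite_true (by simp [hS]) (aux _ _ hS)))
        (by omega)
    · exact Ex.mono (Ex.ite_true (by simp [hS]) (aux _ _ hS)) (by omega)

theorem isSome_head_drop {α : Type*} {l : List α} {k : ℕ} (h : k < l.length) :
    (l.drop k).head?.isSome = true := by
  simp [h]

theorem take_succ_reverse {α : Type*} (l m : List α) (k : ℕ) :
    ((l.drop k).take 1).reverse ++ ((l.take k).reverse ++ m) = (l.take (k + 1)).reverse ++ m := by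
  rw [List.take_add, List.reverse_append, List.append_assoc]

theorem ex_drain (hab : a ≠ b) :
    Ex (drain a b) S (update (update S a []) b ((S a).reverse ++ S b)) (7 * (S a).length + 1) := by
  have := Ex.loop (r := a) (p := Option.isSome) (c := move a b) (B := 6)
    (fun k => update (update S a ((S a).drop k)) b (((S a).take k).reverse ++ S b))
    (S a).length ?_ ?_ ?_
  · refine Ex.mono (c := drain a b) ?_ (show (S a).length * (6 + 1) + 1 ≤ _ by omega)
    simpa [drain] using this
  · intro k hk
    simp only [update_of_ne hab, update_self]
    exact isSome_head_drop hk
  · intro k hk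
    convert ex_move hab using 1
    funext r
    simp only [update_apply]
    split_ifs <;> simp_all [take_succ_reverse]
  · simp [update_of_ne hab]

theorem ex_clear : Ex (clear a) S (update S a []) (2 * (S a).length + 1) := by
  have := Ex.loop (r := a) (p := Option.isSome) (c := .pop a) (B := 1)
    (fun k => update S a ((S a).drop k)) (S a).length ?_ ?_ ?_
  · refine Ex.mono (c := clear a) ?_ (show (S a).length * (1 + 1) + 1 ≤ _ by omega)
    simpa [clear] using this
  · intro k hk
    simp only [update_self]
    exact isSome_head_drop hk
  · intro k hk
    convert Ex.pop _ _ using 1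
    simp
  · simp

/-- This gives random access: the symbol wanted comes to the top of `a`, and the prefix waits
reversed on `b`, from where `drain` can restore it. -/
theorem ex_seek (hab : a ≠ b) (hca : c ≠ a) (hcb : c ≠ b) :
    Ex (seek c a b) S (update (update (update S c []) a ((S a).drop (S c).length)) b
      (((S a).take (S c).length).reverse ++ S b)) (9 * (S c).length + 1) := by
  have := Ex.loop (r := c) (p := Option.isSome) (c := .seq (.pop c) (move a b)) (B := 8)
    (fun k => update (update (update S c ((S c).drop k)) a ((S a).drop k)) b
      (((S a).take k).reverse ++ S b)) (S c).length ?_ ?_ ?_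
  · refine Ex.mono (c := seek c a b) ?_ (show (S c).length * (8 + 1) + 1 ≤ _ by omega)
    simpa [seek] using this
  · intro k hk
    simp only [update_of_ne hcb, update_of_ne hca, update_self]
    exact isSome_head_drop hk
  · intro k hk
    convert (Ex.pop _ _).seq (ex_move hab) using 1
    funext r
    simp only [update_apply]
    split_ifs <;> simp_all [take_succ_reverse]
  · simp [update_of_ne hcb, update_of_ne hca]

/-! ### Computable functions of a context -/

/-- A context: two words (the input and a table) and a list of numbers. -/
class Ctx (γ : Type) where
  word : γ → List Sym
  tab : γ → List Sym
  vars : γ → List ℕ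

/-- The context that consists of an input and a table. -/
abbrev Base := List Sym × List Sym

instance : Ctx Base := ⟨Prod.fst, Prod.snd, fun _ => []⟩

instance {γ : Type} [Ctx γ] : Ctx (γ × ℕ) :=
  ⟨fun g => Ctx.word g.1, fun g => Ctx.tab g.1, fun g => g.2 :: Ctx.vars g.1⟩

open Ctx

/-- All parts of the context have size at most `B`. -/
def Bd {γ : Type} [Ctx γ] (g : γ) (B : ℕ) : Prop :=
  (word g).length ≤ B ∧ (tab g).length ≤ B ∧ ∀ v ∈ vars g, v ≤ B

/-- The store `S` represents the context `g`: the words are on the stacks 0 and 2, the numbers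
on the stacks `rs`, and the stacks from `fr` on are empty. -/
structure Rep {γ : Type} [Ctx γ] (g : γ) (rs : List ℕ) (fr : ℕ) (S : Store) : Prop where
  word : S 0 = word g
  one : S 1 = []
  tab : S 2 = tab g
  three : S 3 = []
  vars : List.Forall₂ (fun r v => S r = un v) rs (vars g)
  fresh : ∀ r ≥ fr, S r = []

/-- Conditions on the stacks of the variables, the first free stack and the target stack. -/
structure Side (rs : List ℕ) (fr dst : ℕ) : Prop where
  four_le : 4 ≤ dst
  dst_lt : dst < fr
  var : ∀ r ∈ rs, 4 ≤ r ∧ r < fr ∧ r ≠ dst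

theorem Rep.congr {γ : Type} [Ctx γ] {g : γ} {rs : List ℕ} {fr fr' : ℕ} {S S' : Store}
    (h : Rep g rs fr S) (h₁ : ∀ r < 4, S' r = S r) (h₂ : ∀ r ∈ rs, S' r = S r)
    (h₃ : ∀ r ≥ fr', S' r = []) : Rep g rs fr' S' where
  word := (h₁ 0 (by omega)).trans h.word
  one := (h₁ 1 (by omega)).trans h.one
  tab := (h₁ 2 (by omega)).trans h.tab
  three := (h₁ 3 (by omega)).trans h.three
  vars := by
    have := h.vars
    rw [List.forall₂_iff_zip] at this ⊢
    exact ⟨this.1, fun hr => (h₂ _ (List.of_mem_zip hr).1).trans (this.2 hr)⟩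
  fresh := h₃

/-- `f` is computed within polynomial time by a program that adds the value of `f` to the number
on a given stack. -/
def Comp {γ : Type} [Ctx γ] (f : γ → ℕ) : Prop :=
  ∃ p : Polynomial ℕ, (∀ g B, Bd g B → f g ≤ p.eval B) ∧
    ∀ rs fr dst, Side rs fr dst → ∃ c, ∀ g B S, Bd g B → Rep g rs fr S →
      Ex c S (update S dst (un (f g) ++ S dst)) (p.eval B)

/-- A decidable predicate of a context. -/
def CompP {γ : Type} [Ctx γ] (P : γ → Prop) : Prop :=
  ∃ f : γ → ℕ, Comp f ∧ (∀ g, f g ≤ 1) ∧ ∀ g, P g ↔ f g = 1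

/-! ### Closure properties of polynomial-time functions -/

namespace Comp

variable {γ : Type} [Ctx γ] {f f₁ f₂ : γ → ℕ}

theorem zero : Comp (fun _ : γ => 0) :=
  ⟨1, by simp, fun rs fr dst _ => ⟨.skip, fun g B S _ _ => by simpa using Ex.skip S⟩⟩

theorem one : Comp (fun _ : γ => 1) :=
  ⟨1, by simp, fun rs fr dst _ =>
    ⟨.push dst (some true), fun g B S _ _ => by simpa [un] using Ex.push dst (some true) S⟩⟩

/-- Programs add to their target stack, so running two of them in sequence is addition. The target
carries no variable, hence the second program still sees the same context. -/
theorem add (h₁ : Comp f₁) (h₂ : Comp f₂) : Comp (fun g => f₁ g + f₂ g) := by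
  obtain ⟨p₁, b₁, h₁⟩ := h₁
  obtain ⟨p₂, b₂, h₂⟩ := h₂
  refine ⟨p₁ + p₂ + 1, fun g B hB => ?_, fun rs fr dst hs => ?_⟩
  · have := b₁ g B hB
    have := b₂ g B hB
    simp
    omega
  · obtain ⟨c₁, h₁⟩ := h₁ rs fr dst hs
    obtain ⟨c₂, h₂⟩ := h₂ rs fr dst hs
    refine ⟨.seq c₁ c₂, fun g B S hB hS => ?_⟩
    have h := (h₁ g B S hB hS).seq (h₂ g B _ hB (hS.congr (fr' := fr) ?_ ?_ ?_))
    · convert h using 1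
      · simp [← List.append_assoc, add_comm]
      · simp
    · intro r hr
      exact update_of_ne (by have := hs.four_le; omega) _ _
    · intro r hr
      exact update_of_ne (hs.var r hr).2.2 _ _
    · intro r hr
      rw [update_of_ne (by have := hs.dst_lt; omega)]
      exact hS.fresh r hr

theorem weaken (h : Comp f) : Comp (fun g : γ × ℕ => f g.1) := by
  obtain ⟨p, b, h⟩ := h
  have hBd : ∀ (g : γ × ℕ) B, Bd g B → Bd g.1 B := fun g B hB =>
    ⟨hB.1, hB.2.1, fun v hv => hB.2.2 v (List.mem_cons_of_mem _ hv)⟩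
  refine ⟨p, fun g B hB => b _ _ (hBd g B hB), fun rs fr dst hs => ?_⟩
  -- A context in `γ × ℕ` has at least one variable, so no store represents it with an empty list of
  -- stacks, and any program will do.
  rcases rs with _ | ⟨r, rs⟩
  · exact ⟨.skip, fun g B S _ hS => by cases hS.vars⟩
  · obtain ⟨c, h⟩ := h rs fr dst ⟨hs.four_le, hs.dst_lt, fun r hr => hs.var r (by simp [hr])⟩
    refine ⟨c, fun g B S hB hS => h _ _ _ (hBd _ _ hB) ⟨hS.word, hS.one, hS.tab, hS.three, ?_,
      hS.fresh⟩⟩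
    have := hS.vars
    exact (List.forall₂_cons.1 this).2

/-- Add the number on `r` to the number on `d`, by means of the empty stack `t`. -/
theorem ex_copy {S : Store} {r t d v : ℕ} (hr : S r = un v) (ht : S t = []) (hrt : r ≠ t)
    (hrd : r ≠ d) (htd : t ≠ d) :
    Ex (.seq (.loop r Option.isSome (.seq (.pop r) (.seq (.push t (some true))
      (.push d (some true))))) (drain t r)) S (update S d (un v ++ S d)) (13 * v + 3) := by
  have h₁ := Ex.loop (r := r) (p := Option.isSome) (c := .seq (.pop r) (.seq
      (.push t (some true)) (.push d (some true)))) (B := 5)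
    (fun k => update (update (update S r (un (v - k))) t (un k)) d (un k ++ S d)) v ?_ ?_ ?_
  · have h₂ := h₁.seq (ex_drain hrt.symm)
    refine Ex.mono (B := (v * (5 + 1) + 1) + (7 * v + 1) + 1) ?_ (by omega)
    convert h₂ using 1
    · simp [← hr, ← ht]
    · funext x
      simp only [update_apply]
      split_ifs <;> simp_all
    · simp [update_of_ne htd]
  · intro k hk
    simp only [update_of_ne hrd, update_of_ne hrt, update_self]
    rw [head_un (by omega)]
    rfl
  · intro k hk
    convert (Ex.pop _ _).seq ((Ex.push _ _ _).seq (Ex.push _ _ _)) using 1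
    funext x
    simp only [update_apply]
    split_ifs <;> simp_all [un_succ, tail_un, Nat.sub_sub]
  · simp [update_of_ne hrd, update_of_ne hrt]

theorem var : Comp (fun g : γ × ℕ => g.2) := by
  refine ⟨13 * Polynomial.X + 3, fun g B hB => ?_, fun rs fr dst hs => ?_⟩
  · have := hB.2.2 g.2 (by simp [Ctx.vars])
    simp
    omega
  · rcases rs with _ | ⟨r, rs⟩
    · exact ⟨.skip, fun g B S _ hS => by cases hS.vars⟩
    · refine ⟨_, fun g B S hB hS => (ex_copy (t := 1) (List.forall₂_cons.1 hS.vars).1 hS.one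
        ?_ ?_ ?_).mono ?_⟩
      · have := hs.var r (by simp); omega
      · have := hs.var r (by simp); omega
      · have := hs.four_le; omega
      · have := hB.2.2 g.2 (by simp [Ctx.vars])
        simp
        omega

end Comp

open Turing Function Cmd Ctx

theorem Ex.congr {c : Cmd} {S S' T T' : Store} {B B' : ℕ} (h : Ex c S S' B) (h₁ : T = S)
    (h₂ : T' = S') (hB : B ≤ B') : Ex c T T' B' := by
  subst h₁ h₂
  exact h.mono hB

namespace Comp

variable {γ : Type} [Ctx γ] {f f₁ f₂ : γ → ℕ}

theorem length_word : Comp (fun g : γ => (word g).length) := by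
  refine ⟨16 * Polynomial.X + 3, fun g B hB => ?_, fun rs fr dst hs => ?_⟩
  · have := hB.1
    simp
    omega
  · refine ⟨.seq (.loop 0 Option.isSome (.seq (move 0 1) (.push dst (some true)))) (drain 1 0),
      fun g B S hB hS => ?_⟩
    have hd := hs.four_le
    have h₁ := Ex.loop (r := 0) (p := Option.isSome) (c := .seq (move 0 1)
      (.push dst (some true))) (B := 8)
      (fun k => update (update (update S 0 ((S 0).drop k)) 1 (((S 0).take k).reverse ++ S 1))
        dst (un k ++ S dst)) (S 0).length ?_ ?_ ?_
    · have h₂ := h₁.seq (ex_drain (a := 1) (b := 0) (by decide))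
      refine Ex.mono (B := ((S 0).length * (8 + 1) + 1) + (7 * (S 0).length + 1) + 1) ?_ ?_
      · convert h₂ using 1
        · simp
        · funext x
          have hw : (word g).length = (S 0).length := by rw [hS.word]
          simp only [update_apply]
          split_ifs <;> first | contradiction | rfl | omega | (subst_vars; simp [hS.one, hw])
        · rw [update_of_ne (by omega)]
          simp [hS.one]
      · have := hB.1
        rw [← hS.word] at this
        simp
        omega
    · intro k hk
      rw [update_of_ne (by omega), update_of_ne (by omega), update_self]
      exact isSome_head_drop hk
    · intro k hk
      convert (ex_move (a := 0) (b := 1) (by decide)).seq (Ex.push _ _ _) using 1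
      funext x
      simp only [update_apply]
      split_ifs <;> first
        | contradiction | rfl | omega | (subst_vars; simp [take_succ_reverse])
    · rw [update_of_ne (by omega), update_of_ne (by omega), update_self]
      simp

/-- Both values are put on fresh stacks, which are popped in parallel until the second is empty.
Popping an empty stack has no effect, which is exactly truncated subtraction. -/
theorem monus (h₁ : Comp f₁) (h₂ : Comp f₂) : Comp (fun g => f₁ g - f₂ g) := by
  obtain ⟨p₁, b₁, h₁⟩ := h₁
  obtain ⟨p₂, b₂, h₂⟩ := h₂
  refine ⟨8 * p₁ + 5 * p₂ + 5, fun g B hB => ?_, fun rs fr dst hs => ?_⟩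
  · have := b₁ g B hB
    simp
    omega
  · have hd := hs.four_le
    have hd' := hs.dst_lt
    obtain ⟨c₁, h₁⟩ := h₁ rs (fr + 1) fr ⟨by omega, by omega, fun r hr => by
      have := hs.var r hr; omega⟩
    obtain ⟨c₂, h₂⟩ := h₂ rs (fr + 2) (fr + 1) ⟨by omega, by omega, fun r hr => by
      have := hs.var r hr; omega⟩
    refine ⟨.seq c₁ (.seq c₂ (.seq (.loop (fr + 1) Option.isSome (.seq (.pop (fr + 1)) (.pop fr)))
      (drain fr dst))), fun g B S hB hS => ?_⟩
    have e₁ := h₁ g B S hB (hS.congr (fun _ _ => rfl) (fun _ _ => rfl)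
      fun r hr => hS.fresh r (by omega))
    have e₂ := h₂ g B (update S fr (un (f₁ g))) hB (hS.congr
      (fun r hr => update_of_ne (by omega) _ _)
      (fun r hr => update_of_ne (by have := hs.var r hr; omega) _ _)
      fun r hr => (update_of_ne (by omega) _ _).trans (hS.fresh r (by omega)))
    have e₃ := Ex.loop (r := fr + 1) (p := Option.isSome) (c := .seq (.pop (fr + 1)) (.pop fr))
      (B := 3) (fun k => update (update S fr (un (f₁ g - k))) (fr + 1) (un (f₂ g - k)))
      (f₂ g) ?_ ?_ ?_
    · have s₀ := hS.fresh fr le_rfl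
      have s₁ := hS.fresh (fr + 1) (by omega)
      simp only [s₀, s₁, List.append_nil, update_of_ne (show fr + 1 ≠ fr by omega)] at e₁ e₂
      refine Ex.mono (e₁.seq (B' := p₂.eval B + ((f₂ g * (3 + 1) + 1) +
        (7 * f₁ g + 1) + 1) + 1) (e₂.seq (e₃.seq ?_))) ?_
      · refine Ex.mono ?_ (show 7 * (f₁ g - f₂ g) + 1 ≤ _ by omega)
        convert ex_drain (a := fr) (b := dst) (by omega) using 1
        · funext x
          simp only [update_apply]
          split_ifs <;> first | contradiction | rfl | omega | (subst_vars; simp [s₀, s₁])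
        · rw [update_of_ne (by omega)]
          simp
      · have := b₁ g B hB
        have := b₂ g B hB
        simp
        omega
    · intro k hk
      rw [update_self, head_un (by omega)]
      rfl
    · intro k hk
      convert (Ex.pop _ _).seq (Ex.pop _ _) using 1
      funext x
      simp only [update_apply]
      split_ifs <;> first | contradiction | rfl | omega | (subst_vars; simp [tail_un, Nat.sub_sub])
    · simp

/-- Stack `fr` counts down from `f₁ g`, stack `fr + 1` carries the summation index as the new
innermost variable, and the summands accumulate on `dst`. Since the index is below `f₁ g`, the
enlarged context has size at most `B + p₁(B)`, whence the composition of polynomials. -/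
theorem sum {f₂ : γ × ℕ → ℕ} (h₁ : Comp f₁) (h₂ : Comp f₂) :
    Comp (fun g => ∑ i ∈ Finset.range (f₁ g), f₂ (g, i)) := by
  obtain ⟨p₁, b₁, h₁⟩ := h₁
  obtain ⟨p₂, b₂, h₂⟩ := h₂
  refine ⟨3 * p₁ + p₁ * (p₂.comp (Polynomial.X + p₁) + 5) + 5, fun g B hB => ?_,
    fun rs fr dst hs => ?_⟩
  all_goals
    have hbd : ∀ (g : γ) B, Bd g B → ∀ i < f₁ g, Bd (g, i) (B + p₁.eval B) := fun g B hB i hi =>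
      ⟨hB.1.trans (by omega), hB.2.1.trans (by omega), by
        have := b₁ g B hB
        intro v hv
        rcases List.mem_cons.1 hv with rfl | hv
        · show v ≤ _
          omega
        · exact (hB.2.2 v hv).trans (by omega)⟩
  · calc ∑ i ∈ Finset.range (f₁ g), f₂ (g, i)
        ≤ ∑ _i ∈ Finset.range (f₁ g), p₂.eval (B + p₁.eval B) :=
          Finset.sum_le_sum fun i hi => b₂ _ _ (hbd g B hB i (Finset.mem_range.1 hi))
      _ = f₁ g * p₂.eval (B + p₁.eval B) := by simp
      _ ≤ p₁.eval B * p₂.eval (B + p₁.eval B) := Nat.mul_le_mul_right _ (b₁ g B hB)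
      _ ≤ _ := by
        simp only [Polynomial.eval_add, Polynomial.eval_mul, Polynomial.eval_comp,
          Polynomial.eval_X, Polynomial.eval_ofNat, mul_add]
        omega
  · have hd := hs.four_le
    have hd' := hs.dst_lt
    obtain ⟨c₁, h₁⟩ := h₁ rs (fr + 1) fr ⟨by omega, by omega, fun r hr => by
      have := hs.var r hr; omega⟩
    obtain ⟨c₂, h₂⟩ := h₂ ((fr + 1) :: rs) (fr + 2) dst ⟨by omega, by omega, fun r hr => by
      rcases List.mem_cons.1 hr with rfl | hr
      · omega
      · have := hs.var r hr; omega⟩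
    refine ⟨.seq c₁ (.seq (.loop fr Option.isSome (.seq (.pop fr) (.seq c₂
      (.push (fr + 1) (some true))))) (clear (fr + 1))), fun g B S hB hS => ?_⟩
    have e₁ := h₁ g B S hB (hS.congr (fun _ _ => rfl) (fun _ _ => rfl)
      fun r hr => hS.fresh r (by omega))
    have s₀ := hS.fresh fr le_rfl
    have s₁ := hS.fresh (fr + 1) (by omega)
    have e₂ := Ex.loop (r := fr) (p := Option.isSome) (c := .seq (.pop fr) (.seq c₂
      (.push (fr + 1) (some true)))) (B := p₂.eval (B + p₁.eval B) + 4)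
      (fun k => update (update (update S fr (un (f₁ g - k))) (fr + 1) (un k)) dst
        (un (∑ i ∈ Finset.range k, f₂ (g, i)) ++ S dst)) (f₁ g) ?_ ?_ ?_
    · simp only [s₀, List.append_nil] at e₁
      refine Ex.mono (e₁.seq (B' := f₁ g * (p₂.eval (B + p₁.eval B) + 4 + 1) + 1 +
        (2 * f₁ g + 1) + 1) (Ex.seq (S' := update (update (update S fr (un (f₁ g - f₁ g)))
          (fr + 1) (un (f₁ g))) dst (un (∑ i ∈ Finset.range (f₁ g), f₂ (g, i)) ++ S dst)) ?_ ?_)) ?_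
      · convert e₂ using 1
        funext x
        simp only [update_apply]
        split_ifs <;> first | contradiction | rfl | omega | (subst_vars; simp [s₁])
      · convert ex_clear (a := fr + 1) using 1
        · funext x
          simp only [update_apply]
          split_ifs <;> first | contradiction | rfl | omega | (subst_vars; simp [s₀, s₁])
        · rw [update_of_ne (by omega)]
          simp
      · have hb := b₁ g B hB
        have := Nat.mul_le_mul_right (p₂.eval (B + p₁.eval B)) hb
        simp only [Polynomial.eval_add, Polynomial.eval_mul, Polynomial.eval_comp,
          Polynomial.eval_X, Polynomial.eval_ofNat, mul_add]
        omega
    · intro k hk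
      rw [update_of_ne (by omega), update_of_ne (by omega), update_self, head_un (by omega)]
      rfl
    · intro k hk
      have e₃ := h₂ (g, k) _ (update (update (update S fr (un (f₁ g - (k + 1)))) (fr + 1) (un k))
        dst (un (∑ i ∈ Finset.range k, f₂ (g, i)) ++ S dst)) (hbd g B hB k hk) ?_
      · have e₄ := (e₃.congr (T' := update (update (update S fr (un (f₁ g - (k + 1))))
          (fr + 1) (un k)) dst (un (∑ i ∈ Finset.range (k + 1), f₂ (g, i)) ++ S dst))
          rfl ?_ le_rfl).seq (Ex.push (fr + 1) (some true) _)
        · refine ((Ex.pop fr _).seq (e₄.congr ?_ rfl le_rfl)).congr rfl ?_ (by omega)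
          · funext x
            simp only [update_apply]
            split_ifs <;> first
              | contradiction | rfl | omega | (subst_vars; simp [tail_un, Nat.sub_sub])
          · funext x
            simp only [update_apply]
            split_ifs <;> first
              | contradiction | rfl | omega
        · funext x
          simp only [update_apply]
          split_ifs <;> first
            | contradiction | rfl | omega
            | (subst_vars; simp [Finset.sum_range_succ, ← List.append_assoc, add_comm])
      · refine ⟨?_, ?_, ?_, ?_, ?_, ?_⟩
        · simp only [update_apply]
          rw [if_neg (by omega), if_neg (by omega), if_neg (by omega)]
          exact hS.word
        · simp only [update_apply]
          rw [if_neg (by omega), if_neg (by omega), if_neg (by omega)]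
          exact hS.one
        · simp only [update_apply]
          rw [if_neg (by omega), if_neg (by omega), if_neg (by omega)]
          exact hS.tab
        · simp only [update_apply]
          rw [if_neg (by omega), if_neg (by omega), if_neg (by omega)]
          exact hS.three
        · refine List.Forall₂.cons ?_ ?_
          · rw [update_of_ne (by omega), update_self]
          · refine (hS.congr (fr' := fr + 2) ?_ ?_ ?_).vars
            · intro r hr
              simp only [update_apply]
              rw [if_neg (by omega), if_neg (by omega), if_neg (by omega)]
            · intro r hr
              have := hs.var r hr
              simp only [update_apply]
              rw [if_neg (by omega), if_neg (by omega), if_neg (by omega)]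
            · intro r hr
              simp only [update_apply]
              rw [if_neg (by omega), if_neg (by omega), if_neg (by omega)]
              exact hS.fresh r (by omega)
        · intro r hr
          simp only [update_apply]
          rw [if_neg (by omega), if_neg (by omega), if_neg (by omega)]
          exact hS.fresh r (by omega)
    · rw [update_of_ne (by omega), update_of_ne (by omega), update_self]
      simp

end Comp

open Turing Function Cmd Ctx

/-! ### Access to the symbols of the input and of the table -/

/-- Read the symbol at position `i` of the word on `a`. -/
theorem ex_read {S : Store} {a b c d i : ℕ} {s : Sym} (hc : S c = un i) (hb : S b = [])
    (hab : a ≠ b) (hca : c ≠ a) (hcb : c ≠ b) (hda : d ≠ a) (hdb : d ≠ b) (hdc : d ≠ c) :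
    Ex (.seq (seek c a b) (.seq (.ite a (· == some s) (.push d (some true)) .skip) (drain b a))) S
      (update (update S c []) d ((if (S a)[i]? = some s then un 1 else []) ++ S d))
      (16 * i + 6) := by
  have hc' : (S c).length = i := by rw [hc, length_un]
  have e₁ := ex_seek (S := S) hab hca hcb
  rw [hc'] at e₁
  have e₂ : Ex (.ite a (· == some s) (.push d (some true)) .skip)
      (update (update (update S c []) a ((S a).drop i)) b (((S a).take i).reverse ++ S b))
      (update (update (update (update S c []) a ((S a).drop i)) b (((S a).take i).reverse ++ S b))
        d ((if (S a)[i]? = some s then un 1 else []) ++ S d)) 2 := by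
    by_cases h : (S a)[i]? = some s
    · refine Ex.ite_true ?_ ((Ex.push d (some true) _).congr rfl ?_ le_rfl)
      · simp [update_of_ne hab, h]
      · simp [update_of_ne hdb, update_of_ne hda, update_of_ne hdc, h, un]
    · refine Ex.ite_false ?_ ((Ex.skip _).congr rfl ?_ le_rfl)
      · simp [update_of_ne hab, h]
      · funext x
        simp only [update_apply, if_neg h]
        split_ifs <;> simp_all
  refine (e₁.seq (e₂.seq (ex_drain hab.symm))).congr rfl ?_ ?_
  · funext x
    simp only [update_apply]
    split_ifs <;> simp_all
  · rw [update_of_ne hdb.symm, update_self, hb, List.append_nil, List.length_reverse]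
    have : ((S a).take i).length ≤ i := List.length_take_le _ _
    omega

namespace Comp

variable {γ : Type} [Ctx γ] {f f₁ f₂ : γ → ℕ}

/-- Treats the input (stack 0 with scratch stack 1) and the table (stack 2 with scratch stack 3)
together. -/
theorem symAt {l : γ → List Sym} {a b : ℕ} (ha : a < 4) (hb : b < 4) (hab : a ≠ b)
    (h : ∀ g rs fr S, Rep g rs fr S → S a = l g ∧ S b = []) (hf : Comp f) (s : Sym) :
    Comp (fun g => if (l g)[f g]? = some s then 1 else 0) := by
  obtain ⟨p, b₀, hf⟩ := hf
  refine ⟨17 * p + 8, fun g B hB => ?_, fun rs fr dst hs => ?_⟩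
  · have : (if (l g)[f g]? = some s then 1 else 0) ≤ 1 := by split_ifs <;> simp
    simp only [Polynomial.eval_add, Polynomial.eval_mul, Polynomial.eval_ofNat]
    omega
  · have hd := hs.four_le
    have hd' := hs.dst_lt
    obtain ⟨c, hf⟩ := hf rs (fr + 1) fr ⟨by omega, by omega, fun r hr => by
      have := hs.var r hr; omega⟩
    refine ⟨.seq c (.seq (seek fr a b) (.seq (.ite a (· == some s) (.push dst (some true)) .skip)
      (drain b a))), fun g B S hB hS => ?_⟩
    obtain ⟨hl, hb'⟩ := h _ _ _ _ hS
    have s₀ := hS.fresh fr le_rfl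
    have e₁ := hf g B S hB (hS.congr (fun _ _ => rfl) (fun _ _ => rfl)
      fun r hr => hS.fresh r (by omega))
    refine (e₁.seq (ex_read (i := f g) (d := dst) (s := s) ?_ ?_ hab ?_ ?_ ?_ ?_ ?_)).congr
      rfl ?_ ?_
    · simp [s₀]
    · rw [update_of_ne (by omega), hb']
    · omega
    · omega
    · omega
    · omega
    · omega
    · funext x
      rw [update_of_ne (show a ≠ fr by omega), update_of_ne (show dst ≠ fr by omega), hl]
      simp only [update_apply]
      split_ifs <;> first
        | contradiction | rfl | omega | (subst_vars; simp [s₀])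
    · have := b₀ g B hB
      simp
      omega

theorem mul (h₁ : Comp f₁) (h₂ : Comp f₂) : Comp (fun g => f₁ g * f₂ g) := by
  simpa using h₁.sum h₂.weaken

theorem const (n : ℕ) : Comp (fun _ : γ => n) := by
  induction n with
  | zero => exact zero
  | succ n ih => exact ih.add one

end Comp

/-! ### Decidable predicates and bounded quantifiers -/

namespace CompP

variable {γ : Type} [Ctx γ] {f f₁ f₂ : γ → ℕ} {P Q : γ → Prop}

theorem indicator [∀ g, Decidable (P g)] (h : CompP P) : Comp (fun g => if P g then 1 else 0) := by
  obtain ⟨f, hf, hf₁, h⟩ := h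
  convert hf using 2 with g
  have := hf₁ g
  have := h g
  split_ifs <;> grind

theorem not (h : CompP P) : CompP (fun g => ¬ P g) := by
  obtain ⟨f, hf, hf₁, h⟩ := h
  refine ⟨_, Comp.one.monus hf, fun g => by omega, fun g => ?_⟩
  have := hf₁ g
  simp only [h]
  omega

theorem and (h₁ : CompP P) (h₂ : CompP Q) : CompP (fun g => P g ∧ Q g) := by
  obtain ⟨f₁, hf₁, hb₁, h₁⟩ := h₁
  obtain ⟨f₂, hf₂, hb₂, h₂⟩ := h₂
  refine ⟨_, hf₁.mul hf₂, fun g => Nat.mul_le_mul (hb₁ g) (hb₂ g), fun g => ?_⟩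
  simp only [h₁, h₂, mul_eq_one]

theorem of_iff (h : CompP P) (hPQ : ∀ g, Q g ↔ P g) : CompP Q := by
  obtain ⟨f, hf, hf₁, h⟩ := h
  exact ⟨f, hf, hf₁, fun g => (hPQ g).trans (h g)⟩

theorem or (h₁ : CompP P) (h₂ : CompP Q) : CompP (fun g => P g ∨ Q g) :=
  (h₁.not.and h₂.not).not.of_iff fun g => by tauto

theorem le (h₁ : Comp f₁) (h₂ : Comp f₂) : CompP (fun g => f₁ g ≤ f₂ g) :=
  ⟨_, Comp.one.monus (h₁.monus h₂), fun g => by omega, fun g => by omega⟩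

theorem lt (h₁ : Comp f₁) (h₂ : Comp f₂) : CompP (fun g => f₁ g < f₂ g) :=
  (le h₂ h₁).not.of_iff fun g => by simp

theorem eq (h₁ : Comp f₁) (h₂ : Comp f₂) : CompP (fun g => f₁ g = f₂ g) :=
  ((le h₁ h₂).and (le h₂ h₁)).of_iff fun _ => le_antisymm_iff

theorem weaken (h : CompP P) : CompP (fun g : γ × ℕ => P g.1) := by
  obtain ⟨f, hf, hf₁, h⟩ := h
  exact ⟨_, hf.weaken, fun g => hf₁ g.1, fun g => h g.1⟩

/-- The sum of the indicators counts the witnesses, and `1 - (1 - count)` turns any positive count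
into 1. -/
theorem exists_lt {P : γ × ℕ → Prop} (h₁ : Comp f₁) (h : CompP P) :
    CompP (fun g => ∃ i < f₁ g, P (g, i)) := by
  obtain ⟨f, hf, hf₁, h⟩ := h
  refine ⟨_, Comp.one.monus (Comp.one.monus (h₁.sum hf)), fun g => by omega, fun g => ?_⟩
  have h₀ : (∑ i ∈ Finset.range (f₁ g), f (g, i)) = 0 ↔ ¬ ∃ i < f₁ g, P (g, i) := by
    rw [Finset.sum_eq_zero_iff]
    push Not
    refine forall_congr' fun i => ?_
    rw [Finset.mem_range, h]
    have := hf₁ (g, i)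
    refine imp_congr_right fun _ => by omega
  rw [← not_iff_not, ← h₀]
  omega

theorem forall_lt {P : γ × ℕ → Prop} (h₁ : Comp f₁) (h : CompP P) :
    CompP (fun g => ∀ i < f₁ g, P (g, i)) :=
  (exists_lt h₁ h.not).not.of_iff fun g => by push Not; rfl

theorem word_eq (hf : Comp f) (s : Sym) : CompP (fun g => (word g)[f g]? = some s) :=
  ⟨_, hf.symAt (a := 0) (b := 1) (by omega) (by omega) (by omega)
    (fun _ _ _ _ hS => ⟨hS.word, hS.one⟩) s, fun g => by split_ifs <;> simp, fun g => by simp⟩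

theorem tab_eq (hf : Comp f) (s : Sym) : CompP (fun g => (tab g)[f g]? = some s) :=
  ⟨_, hf.symAt (a := 2) (b := 3) (by omega) (by omega) (by omega)
    (fun _ _ _ _ hS => ⟨hS.tab, hS.three⟩) s, fun g => by split_ifs <;> simp, fun g => by simp⟩

end CompP

/-! ### Iterated computation of a table -/

open Classical in
/-- The table of the values of `P` at the numbers below `size w`, where `P` may use the
table `T`. -/
noncomputable def nextTab (size : List Sym → ℕ) (P : Base × ℕ → Prop) (w T : List Sym) :
    List Sym :=
  (List.range (size w)).map fun x => some (decide (P ((w, T), x)))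

/-- The store with given contents of the stacks 0, 2 and 4 to 8. -/
def frame (w T l₄ l₅ l₆ l₇ l₈ : List Sym) : Store
  | 0 => w
  | 2 => T
  | 4 => l₄
  | 5 => l₅
  | 6 => l₆
  | 7 => l₇
  | 8 => l₈
  | _ => []

section frame

variable (w T l₄ l₅ l₆ l₇ l₈ l : List Sym)

theorem frame_of_le {r : ℕ} (h : 9 ≤ r) : frame w T l₄ l₅ l₆ l₇ l₈ r = [] := by
  rcases r with _ | _ | _ | _ | _ | _ | _ | _ | _ | r <;> first | omega | rfl

theorem update_frame_zero : update (frame w T l₄ l₅ l₆ l₇ l₈) 0 l = frame l T l₄ l₅ l₆ l₇ l₈ := by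
  funext r
  rcases r with _ | _ | _ | _ | _ | _ | _ | _ | _ | r <;> rfl

theorem update_frame_two : update (frame w T l₄ l₅ l₆ l₇ l₈) 2 l = frame w l l₄ l₅ l₆ l₇ l₈ := by
  funext r
  rcases r with _ | _ | _ | _ | _ | _ | _ | _ | _ | r <;> rfl

theorem update_frame_four : update (frame w T l₄ l₅ l₆ l₇ l₈) 4 l = frame w T l l₅ l₆ l₇ l₈ := by
  funext r
  rcases r with _ | _ | _ | _ | _ | _ | _ | _ | _ | r <;> rfl

theorem update_frame_five : update (frame w T l₄ l₅ l₆ l₇ l₈) 5 l = frame w T l₄ l l₆ l₇ l₈ := by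
  funext r
  rcases r with _ | _ | _ | _ | _ | _ | _ | _ | _ | r <;> rfl

theorem update_frame_six : update (frame w T l₄ l₅ l₆ l₇ l₈) 6 l = frame w T l₄ l₅ l l₇ l₈ := by
  funext r
  rcases r with _ | _ | _ | _ | _ | _ | _ | _ | _ | r <;> rfl

theorem update_frame_seven : update (frame w T l₄ l₅ l₆ l₇ l₈) 7 l = frame w T l₄ l₅ l₆ l l₈ := by
  funext r
  rcases r with _ | _ | _ | _ | _ | _ | _ | _ | _ | r <;> rfl

theorem update_frame_eight : update (frame w T l₄ l₅ l₆ l₇ l₈) 8 l = frame w T l₄ l₅ l₆ l₇ l := by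
  funext r
  rcases r with _ | _ | _ | _ | _ | _ | _ | _ | _ | r <;> rfl

end frame

open Turing Function Cmd Ctx

theorem length_nextTab (size : List Sym → ℕ) (P : Base × ℕ → Prop) (w T : List Sym) :
    (nextTab size P w T).length = size w := by
  simp [nextTab]

-- Stack 4 counts the remaining rounds, 6 the remaining entries, 7 carries the index of the current
-- entry, and 8 receives its truth value. New entries are collected in reverse on 5 while the old
-- table stays readable on 2; the final `drain` restores their order.
open Classical in
theorem ex_round {size : List Sym → ℕ} {P : Base × ℕ → Prop}
    (hs : Comp fun g : Base => size g.1) (hP : CompP P) :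
    ∃ (c : Cmd) (p : Polynomial ℕ), ∀ (w T : List Sym) (k B : ℕ), w.length ≤ B → T.length ≤ B →
      size w ≤ B → Ex c (frame w T (un (k + 1)) [] [] [] [])
        (frame w (nextTab size P w T) (un k) [] [] [] []) (p.eval B) := by
  obtain ⟨ps, _, hs⟩ := hs
  obtain ⟨f, ⟨pf, _, hf⟩, hf₁, hP⟩ := hP
  obtain ⟨cs, hs⟩ := hs [] 7 6 ⟨by omega, by omega, by simp⟩
  obtain ⟨cf, hf⟩ := hf [7] 9 8 ⟨by omega, by omega, by simp⟩
  refine ⟨.seq (.pop 4) (.seq cs (.seq (.loop 6 Option.isSome (.seq (.pop 6) (.seq cf (.seq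
    (.ite 8 Option.isSome (.seq (.pop 8) (.push 5 (some true))) (.push 5 (some false)))
    (.push 7 (some true)))))) (.seq (clear 7) (.seq (clear 2) (drain 5 2))))),
    ps + Polynomial.X * (pf + 10) + 12 * Polynomial.X + 20, fun w T k B hw hT hsz => ?_⟩
  have e₁ := Ex.pop 4 (frame w T (un (k + 1)) [] [] [] [])
  rw [update_frame_four] at e₁
  have e₂ := hs (w, T) B (frame w T (un k) [] [] [] []) ⟨hw, hT, by simp [vars]⟩
    ⟨rfl, rfl, rfl, rfl, .nil, fun r hr => by
      rcases r with _ | _ | _ | _ | _ | _ | _ | _ | _ | r <;> first | omega | rfl⟩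
  rw [update_frame_six] at e₂
  have e₃ := Ex.loop (r := 6) (p := Option.isSome) (c := .seq (.pop 6) (.seq cf (.seq
    (.ite 8 Option.isSome (.seq (.pop 8) (.push 5 (some true))) (.push 5 (some false)))
    (.push 7 (some true))))) (B := pf.eval B + 9)
    (fun i => frame w T (un k) ((nextTab size P w T).take i).reverse (un (size w - i)) (un i) [])
    (size w) ?_ ?_ ?_
  · have e₄ := ex_clear (a := 7) (S := frame w T (un k)
      ((nextTab size P w T).take (size w)).reverse (un (size w - size w)) (un (size w)) [])
    rw [update_frame_seven] at e₄
    have e₅ := ex_clear (a := 2) (S := frame w T (un k)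
      ((nextTab size P w T).take (size w)).reverse (un (size w - size w)) [] [])
    rw [update_frame_two] at e₅
    have e₆ := ex_drain (a := 5) (b := 2) (S := frame w [] (un k)
      ((nextTab size P w T).take (size w)).reverse (un (size w - size w)) [] []) (by omega)
    rw [update_frame_five, update_frame_two] at e₆
    refine (e₁.seq (e₂.seq ((e₃.congr ?_ rfl le_rfl).seq (e₄.seq (e₅.seq e₆))))).congr rfl ?_ ?_
    · simp [frame]
    · simp [frame, List.take_of_length_le, length_nextTab]
    · have := Nat.mul_le_mul_right (pf.eval B + 9 + 1) hsz
      rw [show pf.eval B + 9 + 1 = pf.eval B + 10 by omega] at this ⊢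
      simp [frame, length_nextTab]
      omega
  · intro i hi
    show (un (size w - i)).head?.isSome = true
    rw [head_un (by omega)]
    rfl
  · intro i hi
    have e₁ := Ex.pop 6 (frame w T (un k) ((nextTab size P w T).take i).reverse
      (un (size w - i)) (un i) [])
    rw [update_frame_six] at e₁
    have e₂ := hf ((w, T), i) B (frame w T (un k) ((nextTab size P w T).take i).reverse
      (un (size w - i)).tail (un i) []) ⟨hw, hT, by simp [vars]; omega⟩
      ⟨rfl, rfl, rfl, rfl, .cons rfl .nil, fun r hr => frame_of_le _ _ _ _ _ _ _ hr⟩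
    rw [update_frame_eight] at e₂
    have e₃ : Ex (.ite 8 Option.isSome (.seq (.pop 8) (.push 5 (some true)))
        (.push 5 (some false)))
        (frame w T (un k) ((nextTab size P w T).take i).reverse (un (size w - i)).tail (un i)
          (un (f ((w, T), i))))
        (frame w T (un k) ((nextTab size P w T).take (i + 1)).reverse (un (size w - i)).tail (un i)
          []) 4 := by
      have hnext : ((nextTab size P w T).take (i + 1)).reverse =
          some (decide (P ((w, T), i))) :: ((nextTab size P w T).take i).reverse := by
        rw [List.take_add_one, List.reverse_append]
        simp [nextTab, hi]
      rw [hnext]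
      have := hf₁ ((w, T), i)
      by_cases h : P ((w, T), i)
      · have h₁ := (hP _).1 h
        rw [h₁]
        have e₁ := Ex.pop 8 (frame w T (un k) ((nextTab size P w T).take i).reverse
          (un (size w - i)).tail (un i) (un 1))
        rw [update_frame_eight] at e₁
        have e₂ := Ex.push 5 (some true) (frame w T (un k)
          ((nextTab size P w T).take i).reverse (un (size w - i)).tail (un i) [])
        rw [update_frame_five] at e₂
        refine Ex.ite_true rfl ((e₁.seq e₂).congr rfl ?_ le_rfl)
        simp [h, frame]
      · have h₁ : f ((w, T), i) = 0 := by
          have := mt (hP _).2 h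
          omega
        rw [h₁]
        refine Ex.mono (Ex.ite_false rfl ((Ex.push 5 _ _).congr rfl ?_ le_rfl)) (by omega)
        rw [update_frame_five]
        simp [h, frame]
    have e₄ := Ex.push 7 (some true) (frame w T (un k)
      ((nextTab size P w T).take (i + 1)).reverse (un (size w - i)).tail (un i) [])
    rw [update_frame_seven] at e₄
    refine (e₁.seq ((e₂.congr rfl ?_ le_rfl).seq (e₃.seq e₄))).congr rfl ?_ ?_
    · simp [frame]
    · simp [tail_un, Nat.sub_sub, frame, un_succ]
    · omega
  · simp [frame]

/-! ### From iterated tables to a Turing machine -/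

theorem polyTime_of_comp {α : Type} {ea : α → List Sym} {f : α → Bool}
    {size rounds : List Sym → ℕ} {P : Base × ℕ → Prop} {Q : Base → Prop}
    (hs : Comp fun g : Base => size g.1) (hr : Comp fun g : Base => rounds g.1)
    (hP : CompP P) (hQ : CompP Q)
    (h : ∀ a, f a = true ↔ Q (ea a, (nextTab size P (ea a))^[rounds (ea a)] [])) :
    Nonempty (TM2ComputableInPolyTime ea Computability.encodeBool f) := by
  obtain ⟨cb, pb, hround⟩ := ex_round hs hP
  obtain ⟨ps, hs, -⟩ := hs
  obtain ⟨pr, hrb, hr⟩ := hr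
  obtain ⟨q, ⟨pq, -, hq⟩, hq₁, hQ⟩ := hQ
  obtain ⟨cr, hr⟩ := hr [] 5 4 ⟨by omega, by omega, by simp⟩
  obtain ⟨cq, hq⟩ := hq [] 5 4 ⟨by omega, by omega, by simp⟩
  have hbase : ∀ (w T : List Sym) B, w.length ≤ B → T.length ≤ B → Bd ((w, T) : Base) B :=
    fun w T B hw hT => ⟨hw, hT, by simp [vars]⟩
  have hrep : ∀ w T : List Sym, Rep ((w, T) : Base) [] 5 (frame w T [] [] [] [] []) :=
    fun w T => ⟨rfl, rfl, rfl, rfl, .nil, fun r hr => by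
      rcases r with _ | _ | _ | _ | _ | _ | _ | _ | _ | r <;> first | omega | rfl⟩
  -- `X` bounds the lengths of the input and of all tables at once, so every round obeys the same
  -- time bound.
  let X : Polynomial ℕ := Polynomial.X + ps
  refine polyTime_of_run (.seq cr (.seq (.loop 4 Option.isSome cb) (.seq cq (.seq (clear 0)
    (.seq (clear 2) (.ite 4 Option.isSome (.seq (.pop 4) (.push 1 (some true)))
      (.push 1 (some false))))))))
    (pr + (pr * (pb.comp X + 1) + pq.comp X + 2 * X + 2 * X + 20)) fun a => ?_
  set w := ea a
  set T : ℕ → List Sym := fun k => (nextTab size P w)^[k] []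
  have hsz : size w ≤ ps.eval w.length := hs (w, []) _ (hbase _ _ _ le_rfl (by simp))
  have hX : X.eval w.length = w.length + ps.eval w.length := by simp [X]
  have hT : ∀ k, (T k).length ≤ X.eval w.length := by
    intro k
    rcases k with _ | k
    · simp [T]
    · simp only [T, iterate_succ_apply', length_nextTab]
      omega
  have hw : w.length ≤ X.eval w.length := by omega
  have e₁ := hr (w, []) w.length _ (hbase _ _ _ le_rfl (by simp)) (hrep w [])
  rw [update_frame_four] at e₁
  have e₂ := Ex.loop (r := 4) (p := Option.isSome) (c := cb) (B := pb.eval (X.eval w.length))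
    (fun k => frame w (T k) (un (rounds w - k)) [] [] [] []) (rounds w) ?_ ?_ ?_
  · have e₃ := hq (w, T (rounds w)) _ _ (hbase _ _ _ hw (hT _)) (hrep w _)
    rw [update_frame_four] at e₃
    have e₄ := ex_clear (a := 0) (S := frame w (T (rounds w)) (un (q (w, T (rounds w)))) [] [] [] [])
    rw [update_frame_zero] at e₄
    have e₅ := ex_clear (a := 2) (S := frame [] (T (rounds w))
      (un (q (w, T (rounds w)))) [] [] [] [])
    rw [update_frame_two] at e₅
    have e₆ : Ex (.ite 4 Option.isSome (.seq (.pop 4) (.push 1 (some true)))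
        (.push 1 (some false))) (frame [] [] (un (q (w, T (rounds w)))) [] [] [] [])
        (update (fun _ => []) 1 [some (f a)]) 4 := by
      have hQ' := (h a).trans (hQ (w, T (rounds w)))
      have hle := hq₁ (w, T (rounds w))
      have hpush : ∀ b : Bool, Ex (.push 1 (some b)) (frame [] [] [] [] [] [] [])
          (update (fun _ => []) 1 [some b]) 1 := fun b => by
        refine (Ex.push 1 (some b) _).congr rfl ?_ le_rfl
        funext r
        rcases r with _ | _ | _ | _ | _ | _ | _ | _ | _ | r <;> rfl
      by_cases hf : f a = true
      · rw [hf, hQ'.1 hf]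
        have e := Ex.pop 4 (frame [] [] (un 1) [] [] [] [])
        rw [update_frame_four] at e
        exact Ex.ite_true rfl (e.seq (hpush true))
      · have hz : q (w, T (rounds w)) = 0 := by
          have := mt hQ'.2 hf
          omega
        rw [hz, Bool.eq_false_iff.2 hf]
        exact Ex.mono (Ex.ite_false rfl (hpush false)) (by omega)
    have e₇ := (e₁.congr rfl rfl le_rfl).seq ((e₂.congr ?_ rfl le_rfl).seq
      ((e₃.congr ?_ rfl le_rfl).seq ((e₄.congr ?_ rfl le_rfl).seq (e₅.seq e₆))))
    · refine e₇.congr ?_ rfl ?_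
      · funext r
        rcases r with _ | _ | _ | _ | _ | _ | _ | _ | _ | r <;> rfl
      · have : rounds w * (pb.eval (X.eval w.length) + 1) ≤ _ :=
          Nat.mul_le_mul_right _ (hrb (w, []) _ (hbase _ _ _ le_rfl (by simp)))
        have := hT (rounds w)
        simp only [frame, Polynomial.eval_add, Polynomial.eval_mul, Polynomial.eval_comp,
          Polynomial.eval_ofNat, Polynomial.eval_one]
        omega
    · simp [frame, T]
    · simp
    · simp [frame]
  · intro k hk
    show (un (rounds w - k)).head?.isSome = true
    rw [head_un (by omega)]
    rfl
  · intro k hk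
    rw [show rounds w - k = rounds w - (k + 1) + 1 by omega,
      show T (k + 1) = nextTab size P w (T k) from iterate_succ_apply' _ _ _]
    exact hround w (T k) _ _ hw (hT k) (by omega)
  · simp [frame]

end StackProgram

namespace SPRCombinatorics

open SimpleGraph Function

/-! ### Arcs that miss a point of the circle -/

theorem IsCircleArc.nonempty {A : Set (AddCircle (1 : ℝ))} (hA : IsCircleArc A) : A.Nonempty := by
  obtain ⟨a, b, hab, rfl⟩ := hA
  exact (Set.nonempty_Icc.2 hab).image _

/-- An integer translation brings the left end into `(p, p + 1]`. If the right end then reached `p +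
1`, the arc would contain the point `p`. -/
theorem exists_lift {A : Set (AddCircle (1 : ℝ))} (hA : IsCircleArc A) (p : ℝ)
    (hp : (p : AddCircle (1 : ℝ)) ∉ A) : ∃ l r : ℝ, p < l ∧ l ≤ r ∧ r < p + 1 ∧
      A = (fun x : ℝ => (x : AddCircle (1 : ℝ))) '' Set.Icc l r := by
  obtain ⟨a, b, hab, rfl⟩ := hA
  obtain ⟨n, hn⟩ : ∃ n : ℤ, a + n ∈ Set.Ioc p (p + 1) := by
    refine ⟨-toIocDiv one_pos p a, ?_⟩
    have := sub_toIocDiv_zsmul_mem_Ioc (one_pos : (0 : ℝ) < 1) p a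
    simpa [sub_eq_add_neg] using this
  have hA : (fun x : ℝ => (x : AddCircle (1 : ℝ))) '' Set.Icc a b =
      (fun x : ℝ => (x : AddCircle (1 : ℝ))) '' Set.Icc (a + n) (b + n) := by
    have key : ∀ (x : ℝ) (m : ℤ), ((x + m : ℝ) : AddCircle (1 : ℝ)) = x := fun x m => by
      rw [AddCircle.coe_add, add_eq_left, AddCircle.coe_eq_zero_iff]
      exact ⟨m, by simp⟩
    ext y
    constructor
    · rintro ⟨x, hx, rfl⟩
      exact ⟨x + n, ⟨by linarith [hx.1], by linarith [hx.2]⟩, key x n⟩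
    · rintro ⟨x, hx, rfl⟩
      refine ⟨x - n, ⟨by linarith [hx.1], by linarith [hx.2]⟩, ?_⟩
      have := key (x - n) n
      simp
  refine ⟨a + n, b + n, hn.1, by linarith, ?_, hA⟩
  by_contra! h
  rw [hA] at hp
  refine hp ⟨p + 1, ⟨hn.2, h⟩, ?_⟩
  simp

/-- The projection to the circle is injective on the window from `p` to `p + 1`, so arcs inside it
intersect exactly as real intervals do. -/
theorem inter_nonempty_iff {p l r l' r' : ℝ} (hl : p < l) (hr : r < p + 1) (hl' : p < l')
    (hr' : r' < p + 1) (h : l ≤ r) (h' : l' ≤ r') :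
    ((fun x : ℝ => (x : AddCircle (1 : ℝ))) '' Set.Icc l r ∩
      (fun x : ℝ => (x : AddCircle (1 : ℝ))) '' Set.Icc l' r').Nonempty ↔ l ≤ r' ∧ l' ≤ r := by
  constructor
  · rintro ⟨_, ⟨x, hx, rfl⟩, y, hy, hxy⟩
    have hp : Fact ((0 : ℝ) < 1) := ⟨one_pos⟩
    have : y = x := (AddCircle.coe_eq_coe_iff_of_mem_Ico (a := p)
      ⟨by linarith [hy.1], by linarith [hy.2]⟩ ⟨by linarith [hx.1], by linarith [hx.2]⟩).1 hxy
    subst this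
    exact ⟨hx.1.trans hy.2, hy.1.trans hx.2⟩
  · rintro ⟨h₁, h₂⟩
    exact ⟨_, ⟨max l l', ⟨le_max_left _ _, max_le h h₂⟩, rfl⟩,
      max l l', ⟨le_max_right _ _, max_le h₁ h'⟩, rfl⟩

variable {V : Type*} {G : SimpleGraph V}

/-- Two vertices are equal or adjacent. -/
def Meets (G : SimpleGraph V) (u v : V) : Prop := u = v ∨ G.Adj u v

theorem Meets.symm {u v : V} (h : Meets G u v) : Meets G v u :=
  h.imp Eq.symm fun h => h.symm

/-- In a circular-arc graph, a set of vertices is represented by real intervals, or it meets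
every vertex. -/
theorem intervals_or_dominating (hG : IsCircularArcGraph G) (F : Set V) :
    (∃ l r : V → ℝ, (∀ v ∈ F, l v ≤ r v) ∧
      ∀ u ∈ F, ∀ v ∈ F, (Meets G u v ↔ l u ≤ r v ∧ l v ≤ r u)) ∨
    ∀ x, ∃ v ∈ F, Meets G x v := by
  obtain ⟨arc, harc, hadj⟩ := hG
  have hmeets : ∀ u v, Meets G u v ↔ (arc u ∩ arc v).Nonempty := by
    intro u v
    by_cases h : u = v
    · subst h
      simpa [Meets] using IsCircleArc.nonempty (harc u)
    · simp [Meets, h, hadj u v h]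
  -- If the arcs of `F` miss a point, the circle is cut open there; otherwise they cover the circle,
  -- and any point of an arc lies in one of them.
  by_cases hp : ∃ p : AddCircle (1 : ℝ), ∀ v ∈ F, p ∉ arc v
  · left
    obtain ⟨p, hp⟩ := hp
    obtain ⟨p, rfl⟩ := QuotientAddGroup.mk_surjective p
    have : ∀ v, ∃ l r : ℝ, v ∈ F → p < l ∧ l ≤ r ∧ r < p + 1 ∧
        arc v = (fun x : ℝ => (x : AddCircle (1 : ℝ))) '' Set.Icc l r := by
      intro v
      by_cases hv : v ∈ F
      · obtain ⟨l, r, h⟩ := exists_lift (harc v) p (hp v hv)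
        exact ⟨l, r, fun _ => h⟩
      · exact ⟨0, 0, fun h => absurd h hv⟩
    choose l r hlr using this
    refine ⟨l, r, fun v hv => (hlr v hv).2.1, fun u hu v hv => ?_⟩
    obtain ⟨h₁, h₂, h₃, h₄⟩ := hlr u hu
    obtain ⟨k₁, k₂, k₃, k₄⟩ := hlr v hv
    rw [hmeets, h₄, k₄, inter_nonempty_iff h₁ h₃ k₁ k₃ h₂ k₂]
  · right
    push Not at hp
    intro x
    obtain ⟨y, hy⟩ := IsCircleArc.nonempty (harc x)
    obtain ⟨v, hv, hyv⟩ := hp y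
    exact ⟨v, hv, (hmeets x v).2 ⟨y, hy, hyv⟩⟩

/-! ### Shortest paths as sequences of vertices -/

/-- The sequence of the vertices of a walk of length `d` from `s` to `t`, continued by `t`. -/
structure IsSeq (G : SimpleGraph V) (s t : V) (d : ℕ) (f : ℕ → V) : Prop where
  start : f 0 = s
  adj : ∀ i < d, G.Adj (f i) (f (i + 1))
  eq_end : ∀ i, d ≤ i → f i = t

theorem exists_walk_of_adj {f : ℕ → V} (d : ℕ) : ∀ i, (∀ j < d, G.Adj (f (i + j)) (f (i + j + 1))) →
    ∃ p : G.Walk (f i) (f (i + d)), p.length = d ∧ ∀ j ≤ d, p.getVert j = f (i + j) := by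
  induction d with
  | zero => exact fun i _ => ⟨.nil, rfl, fun j hj => by obtain rfl : j = 0 := by omega
                                                        rfl⟩
  | succ d ih =>
    intro i h
    obtain ⟨p, hp, hpv⟩ := ih (i + 1) fun j hj => by
      have := h (j + 1) (by omega)
      rwa [show i + (j + 1) = i + 1 + j by omega] at this
    refine ⟨(Walk.cons (h 0 (by omega)) p).copy rfl (by congr 1; omega), by simp [hp], ?_⟩
    intro j hj
    rcases j with _ | j
    · simp
    · simp only [Walk.getVert_copy, Walk.getVert_cons_succ]
      rw [hpv j (by omega)]
      congr 1
      omega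

section Seq

variable {s t : V} {d : ℕ} {f g : ℕ → V}

theorem IsSeq.exists_walk (hf : IsSeq G s t d f) {i j : ℕ} (hij : i ≤ j) (hj : j ≤ d) :
    ∃ p : G.Walk (f i) (f j), p.length = j - i := by
  obtain ⟨p, hp, -⟩ := exists_walk_of_adj (G := G) (f := f) (j - i) i
    fun k hk => hf.adj _ (by omega)
  exact ⟨p.copy rfl (by congr 1; omega), by simpa using hp⟩

variable (hmin : ∀ p : G.Walk s t, d ≤ p.length)

include hmin

/-- Following `f` up to position `i`, crossing over, and following `g` from position `k` gives a
walk of length at most `i + 1 + (d - k)`, which cannot be less than `d`. -/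
theorem IsSeq.le_of_meets (hf : IsSeq G s t d f) (hg : IsSeq G s t d g) {i k : ℕ} (hi : i ≤ d)
    (hk : k ≤ d) (h : Meets G (f i) (g k)) : k ≤ i + 1 := by
  obtain ⟨p, hp⟩ := hf.exists_walk (Nat.zero_le i) hi
  obtain ⟨q, hq⟩ := hg.exists_walk hk le_rfl
  rcases h with h | h
  · have := hmin ((p.append (q.copy h.symm rfl)).copy hf.start (hg.eq_end d le_rfl))
    simp [hp, hq] at this
    omega
  · have := hmin ((p.append (Walk.cons h q)).copy hf.start (hg.eq_end d le_rfl))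
    simp [hp, hq] at this
    omega

theorem IsSeq.le_of_eq (hf : IsSeq G s t d f) (hg : IsSeq G s t d g) {i k : ℕ} (hi : i ≤ d)
    (hk : k ≤ d) (h : f i = g k) : k ≤ i := by
  obtain ⟨p, hp⟩ := hf.exists_walk (Nat.zero_le i) hi
  obtain ⟨q, hq⟩ := hg.exists_walk hk le_rfl
  have := hmin ((p.append (q.copy h.symm rfl)).copy hf.start (hg.eq_end d le_rfl))
  simp [hp, hq] at this
  omega

/-- If two shortest paths of length at least five meet before and after a position, then they
meet at this position. -/
theorem IsSeq.meets_between (hG : IsCircularArcGraph G) (hf : IsSeq G s t d f)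
    (hg : IsSeq G s t d g) (hd : 5 ≤ d) {j : ℕ} (hj : j + 2 ≤ d) (h₀ : Meets G (f j) (g j))
    (h₂ : Meets G (f (j + 2)) (g (j + 2))) : Meets G (f (j + 1)) (g (j + 1)) := by
  rcases intervals_or_dominating hG {v | ∃ a, j ≤ a ∧ a ≤ j + 2 ∧ (v = f a ∨ v = g a)} with
    ⟨l, r, hlr, hm⟩ | hdom
  · have mf : ∀ a, j ≤ a → a ≤ j + 2 →
        f a ∈ {v | ∃ a, j ≤ a ∧ a ≤ j + 2 ∧ (v = f a ∨ v = g a)} :=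
      fun a h h' => ⟨a, h, h', Or.inl rfl⟩
    have mg : ∀ a, j ≤ a → a ≤ j + 2 →
        g a ∈ {v | ∃ a, j ≤ a ∧ a ≤ j + 2 ∧ (v = f a ∨ v = g a)} :=
      fun a h h' => ⟨a, h, h', Or.inr rfl⟩
    have f0 := mf j le_rfl (by omega)
    have f1 := mf (j + 1) (by omega) (by omega)
    have f2 := mf (j + 2) (by omega) le_rfl
    have g0 := mg j le_rfl (by omega)
    have g1 := mg (j + 1) (by omega) (by omega)
    have g2 := mg (j + 2) (by omega) le_rfl
    -- Both intervals at position `j` are disjoint from both at `j + 2`. As each of these pairs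
    -- meets, there is a gap between the two unions, and both intervals at `j + 1` must bridge it,
    -- so they meet.
    have n₁ : ¬ Meets G (f j) (f (j + 2)) := fun h => by
      have := hf.le_of_meets hmin hf (by omega) hj h; omega
    have n₂ : ¬ Meets G (f j) (g (j + 2)) := fun h => by
      have := hf.le_of_meets hmin hg (by omega) hj h; omega
    have n₃ : ¬ Meets G (g j) (f (j + 2)) := fun h => by
      have := hg.le_of_meets hmin hf (by omega) hj h; omega
    have n₄ : ¬ Meets G (g j) (g (j + 2)) := fun h => by
      have := hg.le_of_meets hmin hg (by omega) hj h; omega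
    have a₁ := (hm _ f0 _ f1).1 (Or.inr (hf.adj j (by omega)))
    have a₂ := (hm _ f1 _ f2).1 (Or.inr (hf.adj (j + 1) (by omega)))
    have a₃ := (hm _ g0 _ g1).1 (Or.inr (hg.adj j (by omega)))
    have a₄ := (hm _ g1 _ g2).1 (Or.inr (hg.adj (j + 1) (by omega)))
    rw [hm _ f0 _ f2, not_and_or, not_le, not_le] at n₁
    rw [hm _ f0 _ g2, not_and_or, not_le, not_le] at n₂
    rw [hm _ g0 _ f2, not_and_or, not_le, not_le] at n₃
    rw [hm _ g0 _ g2, not_and_or, not_le, not_le] at n₄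
    rw [hm _ f0 _ g0] at h₀
    rw [hm _ f2 _ g2] at h₂
    rw [hm _ f1 _ g1]
    have := hlr _ f0
    have := hlr _ f2
    have := hlr _ g0
    have := hlr _ g2
    constructor <;> rcases n₁ with n₁ | n₁ <;> rcases n₂ with n₂ | n₂ <;>
      rcases n₃ with n₃ | n₃ <;> rcases n₄ with n₄ | n₄ <;> linarith
  -- In the covering case `s` meets a vertex at a position `a ≤ 1` and `t` one at a position `b ≥ d
  -- - 1`, while `b - a ≤ 2`; this forces `d ≤ 4`.
  · exfalso
    obtain ⟨v, ⟨a, ha, ha', hv⟩, hsv⟩ := hdom s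
    obtain ⟨w, ⟨b, hb, hb', hw⟩, htw⟩ := hdom t
    have h₁ : a ≤ 1 := by
      rw [← hf.start] at hsv
      rcases hv with rfl | rfl
      · exact hf.le_of_meets hmin hf (by omega) (by omega) hsv
      · exact hf.le_of_meets hmin hg (by omega) (by omega) hsv
    have h₂ : d ≤ b + 1 := by
      rw [← hf.eq_end d le_rfl] at htw
      rcases hw with rfl | rfl
      · exact hf.le_of_meets hmin hf (by omega) le_rfl htw.symm
      · exact hg.le_of_meets hmin hf (by omega) le_rfl htw.symm
    omega

/-- If two shortest paths of length at least four meet at two consecutive positions, then one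
of them can be left for the other one there. -/
theorem IsSeq.adj_or_adj (hG : IsCircularArcGraph G) (hf : IsSeq G s t d f)
    (hg : IsSeq G s t d g) (hd : 4 ≤ d) {j : ℕ} (hj : j + 1 ≤ d) (h₀ : Meets G (f j) (g j))
    (h₁ : Meets G (f (j + 1)) (g (j + 1))) :
    G.Adj (f j) (g (j + 1)) ∨ G.Adj (g j) (f (j + 1)) := by
  -- Equality is impossible, because a vertex cannot have different positions on two shortest paths.
  suffices h : Meets G (f j) (g (j + 1)) ∨ Meets G (g j) (f (j + 1)) by
    refine h.imp (fun h => h.resolve_left fun h => ?_) (fun h => h.resolve_left fun h => ?_)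
    · have := hf.le_of_eq hmin hg (by omega) hj h; omega
    · have := hg.le_of_eq hmin hf (by omega) hj h; omega
  rcases intervals_or_dominating hG {v | ∃ a, j ≤ a ∧ a ≤ j + 1 ∧ (v = f a ∨ v = g a)} with
    ⟨l, r, hlr, hm⟩ | hdom
  · have mf : ∀ a, j ≤ a → a ≤ j + 1 →
        f a ∈ {v | ∃ a, j ≤ a ∧ a ≤ j + 1 ∧ (v = f a ∨ v = g a)} :=
      fun a h h' => ⟨a, h, h', Or.inl rfl⟩
    have mg : ∀ a, j ≤ a → a ≤ j + 1 →
        g a ∈ {v | ∃ a, j ≤ a ∧ a ≤ j + 1 ∧ (v = f a ∨ v = g a)} :=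
      fun a h h' => ⟨a, h, h', Or.inr rfl⟩
    have f0 := mf j le_rfl (by omega)
    have f1 := mf (j + 1) (by omega) le_rfl
    have g0 := mg j le_rfl (by omega)
    have g1 := mg (j + 1) (by omega) le_rfl
    have a₁ := (hm _ f0 _ f1).1 (Or.inr (hf.adj j (by omega)))
    have a₃ := (hm _ g0 _ g1).1 (Or.inr (hg.adj j (by omega)))
    rw [hm _ f0 _ g0] at h₀
    rw [hm _ f1 _ g1] at h₁
    rw [hm _ f0 _ g1, hm _ g0 _ f1]
    -- Four intervals that meet cyclically have a meeting diagonal: interval graphs contain no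
    -- induced four-cycle.
    by_contra! h
    have := hlr _ f0
    have := hlr _ f1
    have := hlr _ g0
    have := hlr _ g1
    rcases le_or_gt (l (f j)) (r (g (j + 1))) with k₁ | k₁ <;>
      rcases le_or_gt (l (g j)) (r (f (j + 1))) with k₂ | k₂
    · have := h.1 k₁; have := h.2 k₂; linarith
    · have := h.1 k₁; linarith
    · have := h.2 k₂; linarith
    · linarith
  · exfalso
    obtain ⟨v, ⟨a, ha, ha', hv⟩, hsv⟩ := hdom s
    obtain ⟨w, ⟨b, hb, hb', hw⟩, htw⟩ := hdom t
    have h₁ : a ≤ 1 := by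
      rw [← hf.start] at hsv
      rcases hv with rfl | rfl
      · exact hf.le_of_meets hmin hf (by omega) (by omega) hsv
      · exact hf.le_of_meets hmin hg (by omega) (by omega) hsv
    have h₂ : d ≤ b + 1 := by
      rw [← hf.eq_end d le_rfl] at htw
      rcases hw with rfl | rfl
      · exact hf.le_of_meets hmin hf (by omega) le_rfl htw.symm
      · exact hg.le_of_meets hmin hf (by omega) le_rfl htw.symm
    omega

end Seq

/-! ### Reconfiguration of sequences -/

section Reconf

variable {s t : V}

theorem ShortestPath.isSeq (P : ShortestPath G s t) :
    IsSeq G s t (G.dist s t) P.1.getVert where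
  start := P.1.getVert_zero
  adj i hi := P.1.adj_getVert_succ (by rw [P.2]; exact hi)
  eq_end i hi := P.1.getVert_of_length_le (by rw [P.2]; exact hi)

theorem IsSeq.exists_shortestPath {f : ℕ → V} (hf : IsSeq G s t (G.dist s t) f) :
    ∃ P : ShortestPath G s t, P.1.getVert = f := by
  obtain ⟨p, hp, hpv⟩ := exists_walk_of_adj (G := G) (f := f) (G.dist s t) 0
    fun k hk => by simpa using hf.adj k hk
  refine ⟨⟨p.copy hf.start (by rw [zero_add]; exact hf.eq_end _ le_rfl), by simpa using hp⟩, ?_⟩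
  funext i
  rcases le_total i (G.dist s t) with h | h
  · simpa using hpv i h
  · rw [hf.eq_end i h]
    exact Walk.getVert_of_length_le _ (by simpa [hp] using h)

theorem ShortestPath.ext {P Q : ShortestPath G s t} (h : P.1.getVert = Q.1.getVert) : P = Q :=
  Subtype.ext (Walk.ext_getVert fun k => congrFun h k)

/-- A step changes one inner vertex, and the vertices before and after it still meet `P`; by
`IsSeq.meets_between` the new vertex meets `P` too. -/
theorem meets_of_reconfigurable (hG : IsCircularArcGraph G) (hd : 5 ≤ G.dist s t)
    {P Q : ShortestPath G s t} (h : Reconfigurable P Q) (i : ℕ) :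
    Meets G (P.1.getVert i) (Q.1.getVert i) := by
  induction h generalizing i with
  | refl => exact Or.inl rfl
  | @tail Q R _ hstep ih =>
    obtain ⟨j, hj, huniq⟩ := hstep
    have heq : ∀ k, k ≠ j → Q.1.getVert k = R.1.getVert k := fun k hk =>
      not_not.1 fun h => hk (huniq k h)
    by_cases hij : i = j
    · subst hij
      have h0 : i ≠ 0 := by
        rintro rfl
        simp at hj
      have hlt : i < G.dist s t := by
        by_contra! h
        exact hj ((ShortestPath.isSeq Q).eq_end i h |>.trans ((ShortestPath.isSeq R).eq_end i h).symm)
      obtain ⟨i, rfl⟩ := Nat.exists_eq_succ_of_ne_zero h0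
      refine (ShortestPath.isSeq P).meets_between (fun p => dist_le p) hG (ShortestPath.isSeq R) hd
        (j := i) hlt ?_ ?_
      · rw [← heq i (by omega)]
        exact ih i
      · rw [← heq (i + 2) (by omega)]
        exact ih (i + 2)
    · rw [← heq i hij]
      exact ih i

/-- Take the first `j` with `g j` adjacent to `f (j + 1)` and a difference at or before `j`;
position `d - 1` qualifies because both paths end in `t`. Minimality forces `f (j - 1)` to be
adjacent to `g j`, so `g j` fits into `f` on both sides. -/
theorem exists_swap {d : ℕ} {f g : ℕ → V} (hf : IsSeq G s t d f) (hg : IsSeq G s t d g)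
    (h : ∀ j < d, G.Adj (f j) (g (j + 1)) ∨ G.Adj (g j) (f (j + 1))) (hfg : f ≠ g) :
    ∃ j, f j ≠ g j ∧ IsSeq G s t d (update f j (g j)) := by
  have hex : ∃ j, (∃ i ≤ j, f i ≠ g i) ∧ j < d ∧ G.Adj (g j) (f (j + 1)) := by
    obtain ⟨i, hi⟩ := Function.ne_iff.1 hfg
    have hid : i < d := by
      by_contra! h
      exact hi ((hf.eq_end i h).trans (hg.eq_end i h).symm)
    refine ⟨d - 1, ⟨i, by omega, hi⟩, by omega, ?_⟩
    have := hg.adj (d - 1) (by omega)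
    rw [Nat.sub_add_cancel (by omega)] at this ⊢
    rwa [hf.eq_end d le_rfl, ← hg.eq_end d le_rfl]
  classical
  obtain ⟨⟨i, hij, hi⟩, hjd, hadj⟩ := Nat.find_spec hex
  have hlt := fun k hk => Nat.find_min hex (m := k) hk
  set j := Nat.find hex
  have h0 : j ≠ 0 := by
    intro h0
    obtain rfl : i = 0 := by omega
    exact hi (hf.start.trans hg.start.symm)
  obtain ⟨k, hk⟩ := Nat.exists_eq_succ_of_ne_zero h0
  have hprev : f j ≠ g j ∧ G.Adj (f k) (g j) := by
    by_cases hik : i ≤ k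
    · have hn : ¬ G.Adj (g k) (f (k + 1)) := fun hn => hlt k (by omega) ⟨⟨i, hik, hi⟩, by omega, hn⟩
      rw [hk]
      refine ⟨fun he => hn ?_, (h k (by omega)).resolve_right hn⟩
      rw [show f (k + 1) = g (k + 1) from he]
      exact hg.adj k (by omega)
    · obtain rfl : i = j := by omega
      refine ⟨hi, ?_⟩
      by_cases hfk : f k = g k
      · rw [hfk, hk]
        exact hg.adj k (by omega)
      · have hn : ¬ G.Adj (g k) (f (k + 1)) :=
          fun hn => hlt k (by omega) ⟨⟨k, le_rfl, hfk⟩, by omega, hn⟩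
        rw [hk]
        exact (h k (by omega)).resolve_right hn
  refine ⟨j, hprev.1, ?_, fun a ha => ?_, fun a ha => ?_⟩
  · rw [update_of_ne (Ne.symm h0)]
    exact hf.start
  · by_cases h₁ : a = j
    · subst h₁
      rw [update_self, update_of_ne (by omega)]
      exact hadj
    · rw [update_of_ne h₁]
      by_cases h₂ : a + 1 = j
      · rw [h₂, update_self, show a = k by omega]
        exact hprev.2
      · rw [update_of_ne h₂]
        exact hf.adj a ha
  · rw [update_of_ne (by omega)]
    exact hf.eq_end a ha

/-- Each swap lowers the number of differences from `Q`. The hypothesis survives because the new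
path agrees with `Q` at the swapped position, where the edges of `Q` provide the required
adjacencies. -/
theorem reconfigurable_of_adj {P Q : ShortestPath G s t}
    (h : ∀ j < G.dist s t, G.Adj (P.1.getVert j) (Q.1.getVert (j + 1)) ∨
      G.Adj (Q.1.getVert j) (P.1.getVert (j + 1))) : Reconfigurable P Q := by
  classical
  generalize hn : ((Finset.range (G.dist s t)).filter
    fun i => P.1.getVert i ≠ Q.1.getVert i).card = n
  induction n using Nat.strong_induction_on generalizing P with
  | _ n ih =>
    by_cases hPQ : P = Q
    · subst hPQ
      exact .refl
    obtain ⟨j, hj, hseq⟩ := exists_swap (ShortestPath.isSeq P) (ShortestPath.isSeq Q) h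
      fun h => hPQ (ShortestPath.ext h)
    obtain ⟨R, hR⟩ := hseq.exists_shortestPath
    have hjd : j < G.dist s t := by
      by_contra! h
      exact hj ((ShortestPath.isSeq P).eq_end j h |>.trans ((ShortestPath.isSeq Q).eq_end j h).symm)
    refine .head (b := R) ⟨j, ?_, ?_⟩ (ih _ ?_ ?_ rfl)
    · simpa [hR] using hj
    · intro k hk
      by_contra hkj
      rw [hR] at hk
      exact hk (update_of_ne hkj _ _).symm
    · rw [← hn]
      apply Finset.card_lt_card
      rw [Finset.ssubset_iff_of_subset]
      · exact ⟨j, by simp [hjd, hj], by simp [hR]⟩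
      · intro k
        simp only [Finset.mem_filter, hR]
        by_cases hkj : k = j
        · subst hkj
          simp
        · rw [update_of_ne hkj]
          exact id
    · intro k hk
      rw [hR]
      by_cases h₁ : k = j
      · subst h₁
        rw [update_self]
        exact Or.inl ((ShortestPath.isSeq Q).adj k hk)
      · rw [update_of_ne h₁]
        by_cases h₂ : k + 1 = j
        · rw [h₂, update_self, ← h₂]
          exact Or.inr ((ShortestPath.isSeq Q).adj k hk)
        · rw [update_of_ne h₂]
          exact h k hk

theorem reconfigurable_iff_meets (hG : IsCircularArcGraph G) (hd : 5 ≤ G.dist s t)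
    {P Q : ShortestPath G s t} :
    Reconfigurable P Q ↔ ∀ i < G.dist s t, Meets G (P.1.getVert i) (Q.1.getVert i) := by
  refine ⟨fun h i _ => meets_of_reconfigurable hG hd h i, fun h => reconfigurable_of_adj fun j hj =>
    (ShortestPath.isSeq P).adj_or_adj (fun p => dist_le p) hG (ShortestPath.isSeq Q) (by omega) hj
      (h j hj) ?_⟩
  rcases Nat.lt_or_ge (j + 1) (G.dist s t) with h' | h'
  · exact h _ h'
  · left
    rw [(ShortestPath.isSeq P).eq_end _ h', (ShortestPath.isSeq Q).eq_end _ h']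

end Reconf

end SPRCombinatorics

namespace SPRWord

open StackProgram Ctx

/-! ### Reading an instance from its word -/

/-- The number of leading ones: the number of vertices. -/
def num (w : List Sym) : ℕ :=
  ∑ x ∈ Finset.range w.length, if ∀ y < x + 1, w[y]? = some (some true) then 1 else 0

/-- The adjacency relation that is given by the matrix. -/
def WAdj (w : List Sym) (u v : ℕ) : Prop :=
  w[(num w + 1) + (u * (num w + 1) + v)]? = some (some true)

/-- The length of the number of vertices and the matrix. -/
def base (w : List Sym) : ℕ := (num w + 1) * (num w + 1)

/-- The number of zeros among the first `x` symbols. -/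
def cnt (w : List Sym) (x : ℕ) : ℕ :=
  ∑ y ∈ Finset.range x, if w[y]? = some (some false) then 1 else 0

/-- The number that is written in unary as the `i`-th block after the matrix. -/
def blk (w : List Sym) (i : ℕ) : ℕ :=
  ∑ x ∈ Finset.range (w.length - base w),
    if w[base w + x]? = some (some true) ∧ cnt w (base w + x) - cnt w (base w) = i then 1 else 0

/-- The number of blocks after the matrix. -/
def zeros (w : List Sym) : ℕ := cnt w w.length - cnt w (base w)

/-- The length of the paths. -/
def len (w : List Sym) : ℕ :=
  ∑ x ∈ Finset.range (zeros w), if 2 * x + 4 < zeros w then 1 else 0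

/-- The `i`-th vertex of the first path. -/
def pvert (w : List Sym) (i : ℕ) : ℕ := blk w (i - (i - len w) + 2)

/-- The `i`-th vertex of the second path. -/
def qvert (w : List Sym) (i : ℕ) : ℕ := blk w (i - (i - len w) + (len w + 3))

/-- The code of a triple of vertices. -/
def code (n a b c : ℕ) : ℕ := (a * n + b) * n + c

/-- `u` and `v` can be at the positions `i` and `i + 1` of a path. -/
def Step (w : List Sym) (i u v : ℕ) : Prop :=
  (i < len w ∧ WAdj w u v) ∨ (len w ≤ i ∧ u = blk w 1 ∧ v = blk w 1)

/-- `a`, `b`, `c` are the vertices at the positions one to three of a path of length at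
most four. -/
def Valid (w : List Sym) (a b c : ℕ) : Prop :=
  Step w 0 (blk w 0) a ∧ Step w 1 a b ∧ Step w 2 b c ∧ Step w 3 c (blk w 1)

/-- The triple is the triple of the first path, or it is next to a triple in the table. -/
def Near (w T : List Sym) (a b c : ℕ) : Prop :=
  (a = pvert w 1 ∧ b = pvert w 2 ∧ c = pvert w 3) ∨
    ∃ y < num w, T[code (num w) y b c]? = some (some true) ∨
      T[code (num w) a y c]? = some (some true) ∨ T[code (num w) a b y]? = some (some true)

/-- The condition for the entry with the number `x` of the next table. -/
def Entry (g : Base × ℕ) : Prop :=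
  ∃ a < num g.1.1, ∃ b < num g.1.1, ∃ c < num g.1.1, g.2 = code (num g.1.1) a b c ∧
    Valid g.1.1 a b c ∧ Near g.1.1 g.1.2 a b c

/-- The answer. -/
def Answer (g : Base) : Prop :=
  (5 ≤ len g.1 ∧ ∀ i < len g.1,
    pvert g.1 i = qvert g.1 i ∨ WAdj g.1 (pvert g.1 i) (qvert g.1 i)) ∨
  (len g.1 ≤ 4 ∧
    g.2[code (num g.1) (qvert g.1 1) (qvert g.1 2) (qvert g.1 3)]? = some (some true))

section Comp

variable {γ : Type} [Ctx γ] {f f₁ f₂ f₃ : γ → ℕ}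

theorem comp_num : Comp (fun g : γ => num (word g)) :=
  Comp.sum (f₂ := fun g : γ × ℕ => if ∀ y < g.2 + 1, (word g.1)[y]? = some (some true) then 1 else 0)
    Comp.length_word (CompP.indicator (CompP.forall_lt
      (P := fun g : (γ × ℕ) × ℕ => (word g.1.1)[g.2]? = some (some true))
      (Comp.var.add Comp.one) (CompP.word_eq Comp.var _)))

theorem compP_wAdj (h₁ : Comp f₁) (h₂ : Comp f₂) :
    CompP (fun g => WAdj (word g) (f₁ g) (f₂ g)) :=
  CompP.word_eq ((comp_num.add Comp.one).add ((h₁.mul (comp_num.add Comp.one)).add h₂)) _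

theorem comp_base : Comp (fun g : γ => base (word g)) :=
  (comp_num.add Comp.one).mul (comp_num.add Comp.one)

theorem comp_cnt (h : Comp f) : Comp (fun g => cnt (word g) (f g)) :=
  Comp.sum (f₂ := fun g : γ × ℕ => if (word g.1)[g.2]? = some (some false) then 1 else 0)
    h (CompP.indicator (CompP.word_eq Comp.var _))

theorem comp_blk (h : Comp f) : Comp (fun g => blk (word g) (f g)) :=
  Comp.sum (f₂ := fun g : γ × ℕ => if (word g.1)[base (word g.1) + g.2]? = some (some true) ∧
      cnt (word g.1) (base (word g.1) + g.2) - cnt (word g.1) (base (word g.1)) = f g.1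
      then 1 else 0)
    (Comp.length_word.monus comp_base)
    (CompP.indicator ((CompP.word_eq ((Comp.weaken comp_base).add Comp.var) _).and
      (CompP.eq ((comp_cnt (γ := γ × ℕ) ((Comp.weaken comp_base).add Comp.var)).monus
        (Comp.weaken (comp_cnt comp_base))) h.weaken)))

theorem comp_zeros : Comp (fun g : γ => zeros (word g)) :=
  (comp_cnt Comp.length_word).monus (comp_cnt comp_base)

theorem comp_len : Comp (fun g : γ => len (word g)) :=
  Comp.sum (f₂ := fun g : γ × ℕ => if 2 * g.2 + 4 < zeros (word g.1) then 1 else 0)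
    comp_zeros (CompP.indicator (CompP.lt (((Comp.const 2).mul Comp.var).add (Comp.const 4))
      comp_zeros.weaken))

theorem comp_pvert (h : Comp f) : Comp (fun g => pvert (word g) (f g)) :=
  comp_blk ((h.monus (h.monus comp_len)).add (Comp.const 2))

theorem comp_qvert (h : Comp f) : Comp (fun g => qvert (word g) (f g)) :=
  comp_blk ((h.monus (h.monus comp_len)).add (comp_len.add (Comp.const 3)))

theorem comp_code (h₁ : Comp f₁) (h₂ : Comp f₂) (h₃ : Comp f₃) :
    Comp (fun g => code (num (word g)) (f₁ g) (f₂ g) (f₃ g)) :=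
  ((((h₁.mul comp_num).add h₂).mul comp_num).add h₃)

theorem compP_step (h₁ : Comp f₁) (h₂ : Comp f₂) (h₃ : Comp f₃) :
    CompP (fun g => Step (word g) (f₁ g) (f₂ g) (f₃ g)) :=
  ((CompP.lt h₁ comp_len).and (compP_wAdj h₂ h₃)).or ((CompP.le comp_len h₁).and
    ((CompP.eq h₂ (comp_blk Comp.one)).and (CompP.eq h₃ (comp_blk Comp.one))))

theorem compP_valid (h₁ : Comp f₁) (h₂ : Comp f₂) (h₃ : Comp f₃) :
    CompP (fun g => Valid (word g) (f₁ g) (f₂ g) (f₃ g)) :=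
  (compP_step Comp.zero (comp_blk Comp.zero) h₁).and ((compP_step Comp.one h₁ h₂).and
    ((compP_step (Comp.const 2) h₂ h₃).and (compP_step (Comp.const 3) h₃ (comp_blk Comp.one))))

theorem compP_near (h₁ : Comp f₁) (h₂ : Comp f₂) (h₃ : Comp f₃) :
    CompP (fun g => Near (word g) (tab g) (f₁ g) (f₂ g) (f₃ g)) :=
  ((CompP.eq h₁ (comp_pvert Comp.one)).and ((CompP.eq h₂ (comp_pvert (Comp.const 2))).and
    (CompP.eq h₃ (comp_pvert (Comp.const 3))))).or
  (CompP.exists_lt (P := fun g : γ × ℕ =>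
      (tab g.1)[code (num (word g.1)) g.2 (f₂ g.1) (f₃ g.1)]? = some (some true) ∨
      (tab g.1)[code (num (word g.1)) (f₁ g.1) g.2 (f₃ g.1)]? = some (some true) ∨
      (tab g.1)[code (num (word g.1)) (f₁ g.1) (f₂ g.1) g.2]? = some (some true))
    comp_num ((CompP.tab_eq (comp_code (γ := γ × ℕ) Comp.var h₂.weaken h₃.weaken) _).or
      ((CompP.tab_eq (comp_code (γ := γ × ℕ) h₁.weaken Comp.var h₃.weaken) _).or
        (CompP.tab_eq (comp_code (γ := γ × ℕ) h₁.weaken h₂.weaken Comp.var) _))))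

theorem compP_entry : CompP Entry :=
  CompP.exists_lt (P := fun g : (Base × ℕ) × ℕ => ∃ b < num g.1.1.1, ∃ c < num g.1.1.1,
      g.1.2 = code (num g.1.1.1) g.2 b c ∧ Valid g.1.1.1 g.2 b c ∧
        Near g.1.1.1 g.1.1.2 g.2 b c)
    (comp_num (γ := Base × ℕ)) (CompP.exists_lt (P := fun g : ((Base × ℕ) × ℕ) × ℕ =>
      ∃ c < num g.1.1.1.1, g.1.1.2 = code (num g.1.1.1.1) g.1.2 g.2 c ∧
        Valid g.1.1.1.1 g.1.2 g.2 c ∧ Near g.1.1.1.1 g.1.1.1.2 g.1.2 g.2 c)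
    (comp_num (γ := (Base × ℕ) × ℕ)) (CompP.exists_lt (P := fun g : (((Base × ℕ) × ℕ) × ℕ) × ℕ =>
      g.1.1.1.2 = code (num g.1.1.1.1.1) g.1.1.2 g.1.2 g.2 ∧
        Valid g.1.1.1.1.1 g.1.1.2 g.1.2 g.2 ∧ Near g.1.1.1.1.1 g.1.1.1.1.2 g.1.1.2 g.1.2 g.2)
    (comp_num (γ := ((Base × ℕ) × ℕ) × ℕ))
    ((CompP.eq Comp.var.weaken.weaken.weaken
      (comp_code (γ := (((Base × ℕ) × ℕ) × ℕ) × ℕ) Comp.var.weaken.weaken Comp.var.weaken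
        Comp.var)).and
      ((compP_valid (γ := (((Base × ℕ) × ℕ) × ℕ) × ℕ) Comp.var.weaken.weaken Comp.var.weaken
        Comp.var).and
      (compP_near (γ := (((Base × ℕ) × ℕ) × ℕ) × ℕ) Comp.var.weaken.weaken Comp.var.weaken
        Comp.var)))))

theorem compP_answer : CompP Answer :=
  ((CompP.le (Comp.const 5) (comp_len (γ := Base))).and
    (CompP.forall_lt (P := fun g : Base × ℕ => pvert g.1.1 g.2 = qvert g.1.1 g.2 ∨
        WAdj g.1.1 (pvert g.1.1 g.2) (qvert g.1.1 g.2))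
      (comp_len (γ := Base))
      ((CompP.eq (comp_pvert (γ := Base × ℕ) Comp.var) (comp_qvert (γ := Base × ℕ) Comp.var)).or
        (compP_wAdj (γ := Base × ℕ) (comp_pvert (γ := Base × ℕ) Comp.var)
          (comp_qvert (γ := Base × ℕ) Comp.var))))).or
  ((CompP.le (comp_len (γ := Base)) (Comp.const 4)).and
    (CompP.tab_eq (comp_code (γ := Base) (comp_qvert Comp.one) (comp_qvert (Comp.const 2))
      (comp_qvert (Comp.const 3))) _))

end Comp

open StackProgram Ctx SPRInstance SPRCombinatorics

/-! ### The words of instances -/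

theorem sum_ite_lt {m n : ℕ} (h : m ≤ n) :
    (∑ x ∈ Finset.range n, if x < m then 1 else 0) = m := by
  rw [← Finset.card_filter]
  have : (Finset.range n).filter (· < m) = Finset.range m := by
    ext x
    simp only [Finset.mem_filter, Finset.mem_range]
    omega
  rw [this, Finset.card_range]

theorem length_encodeNat (k : ℕ) : (encodeNat k).length = k + 1 := by simp [encodeNat]

theorem num_encodeNat (k : ℕ) (R : List Sym) : num (encodeNat k ++ R) = k := by
  have hlt : ∀ y < k, (encodeNat k ++ R)[y]? = some (some true) := by
    intro y hy
    rw [List.getElem?_append_left (by rw [length_encodeNat]; omega), encodeNat,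
      List.getElem?_append_left (by simpa using hy), List.getElem?_replicate, if_pos hy]
  have hk : (encodeNat k ++ R)[k]? ≠ some (some true) := by
    rw [List.getElem?_append_left (by rw [length_encodeNat]; omega), encodeNat,
      List.getElem?_append_right (by simp)]
    simp
  have : ∀ x, (∀ y < x + 1, (encodeNat k ++ R)[y]? = some (some true)) ↔ x < k := by
    intro x
    refine ⟨fun h => ?_, fun h y hy => hlt y (by omega)⟩
    by_contra! hx
    exact hk (h k (by omega))
  simp only [num, this]
  exact sum_ite_lt (by rw [List.length_append, length_encodeNat]; omega)

theorem getElem?_flatMap_of_length {α β : Type*} {m : ℕ} (f : α → List β)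
    (hf : ∀ a, (f a).length = m) (l : List α) {u v : ℕ} (hu : u < l.length) (hv : v < m) :
    (l.flatMap f)[u * m + v]? = (f l[u])[v]? := by
  induction l generalizing u with
  | nil => simp at hu
  | cons a l ih =>
    rw [List.flatMap_cons]
    rcases u with _ | u
    · rw [List.getElem?_append_left (by rw [hf]; omega)]
      simp
    · rw [List.getElem?_append_right (by rw [hf]; nlinarith), hf,
        show (u + 1) * m + v - m = u * m + v by rw [Nat.succ_mul]; omega]
      exact ih (by simpa using hu)

theorem length_flatMap_of_length {α β : Type*} {m : ℕ} (f : α → List β)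
    (hf : ∀ a, (f a).length = m) (l : List α) : (l.flatMap f).length = l.length * m := by
  induction l with
  | nil => simp
  | cons a l ih => rw [List.flatMap_cons, List.length_append, ih, hf, List.length_cons,
      Nat.succ_mul, add_comm]

open Classical in
theorem getElem?_encodeGraph {n : ℕ} (G : SimpleGraph (Fin n)) (u v : Fin n) :
    (encodeGraph G)[u.val * (n + 1) + v.val]? = some (some (decide (G.Adj u v))) := by
  rw [encodeGraph, getElem?_flatMap_of_length (m := n + 1) _ (by simp) _ (by simp) (by omega),
    List.getElem?_append_left (by simp)]
  simp

theorem length_encodeGraph {n : ℕ} (G : SimpleGraph (Fin n)) :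
    (encodeGraph G).length = n * (n + 1) := by
  rw [encodeGraph, length_flatMap_of_length (m := n + 1) _ (by simp), List.length_finRange]

theorem cnt_eq_count (w : List Sym) (x : ℕ) : cnt w x = (w.take x).count (some false) := by
  induction x with
  | zero => simp [cnt]
  | succ x ih =>
    rw [cnt, Finset.sum_range_succ, ← cnt, ih, List.take_add_one, List.count_append]
    congr 1
    rcases w[x]? with _ | a
    · simp
    · by_cases h : a = some false <;> simp [h]

theorem cnt_append (A R : List Sym) (x : ℕ) :
    cnt (A ++ R) (A.length + x) - cnt (A ++ R) A.length = (R.take x).count (some false) := by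
  simp [cnt_eq_count, List.take_length_add_append]

/-- The number that is written in unary as the `i`-th block of a word. -/
def blkOf (R : List Sym) (i : ℕ) : ℕ :=
  ∑ x ∈ Finset.range R.length,
    if R[x]? = some (some true) ∧ (R.take x).count (some false) = i then 1 else 0

theorem blk_append {A R : List Sym} (h : base (A ++ R) = A.length) (i : ℕ) :
    blk (A ++ R) i = blkOf R i := by
  rw [blk, blkOf, h, List.length_append, Nat.add_sub_cancel_left]
  simp only [cnt_append, List.getElem?_append_right (Nat.le_add_right _ _),
    Nat.add_sub_cancel_left]

theorem zeros_append {A R : List Sym} (h : base (A ++ R) = A.length) :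
    zeros (A ++ R) = R.count (some false) := by
  rw [zeros, h, List.length_append, cnt_append, List.take_length]

theorem blkOf_cons (a : Sym) (R : List Sym) (i : ℕ) :
    blkOf (a :: R) i = (if a = some true ∧ 0 = i then 1 else 0) +
      ∑ x ∈ Finset.range R.length, if R[x]? = some (some true) ∧
        (R.take x).count (some false) + (if a = some false then 1 else 0) = i then 1 else 0 := by
  rw [blkOf, List.length_cons, Finset.sum_range_succ', add_comm]
  simp [List.count_cons]

theorem blkOf_encodeNat_zero (k : ℕ) (R : List Sym) : blkOf (encodeNat k ++ R) 0 = k := by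
  induction k with
  | zero => simp [encodeNat, blkOf_cons]
  | succ k ih =>
    have : encodeNat (k + 1) ++ R = some true :: (encodeNat k ++ R) := by
      simp [encodeNat, List.replicate_succ]
    rw [this, blkOf_cons]
    simp only [and_self, if_true, if_false, Option.some.injEq, Bool.true_eq_false,
      add_zero, ← blkOf.eq_1]
    rw [ih, add_comm]

theorem blkOf_encodeNat_succ (k : ℕ) (R : List Sym) (i : ℕ) :
    blkOf (encodeNat k ++ R) (i + 1) = blkOf R i := by
  induction k with
  | zero =>
    rw [show encodeNat 0 ++ R = some false :: R from rfl, blkOf_cons]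
    simp [blkOf]
  | succ k ih =>
    have : encodeNat (k + 1) ++ R = some true :: (encodeNat k ++ R) := by
      simp [encodeNat, List.replicate_succ]
    rw [this, blkOf_cons, ← ih]
    simp [blkOf]

/-- Separators are neither ones nor zeros, so the numbering of the blocks does not see them. -/
theorem blkOf_none (R : List Sym) (i : ℕ) : blkOf (none :: R) i = blkOf R i := by
  rw [blkOf_cons]
  simp [blkOf]

theorem blkOf_flatMap {α : Type*} (f : α → ℕ) (l : List α) (R : List Sym) {i : ℕ}
    (hi : i < l.length) : blkOf (l.flatMap (fun a => encodeNat (f a)) ++ R) i = f l[i] := by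
  induction l generalizing i with
  | nil => simp at hi
  | cons a l ih =>
    rw [List.flatMap_cons, List.append_assoc]
    rcases i with _ | i
    · rw [blkOf_encodeNat_zero]
      rfl
    · rw [blkOf_encodeNat_succ, ih (by simpa using hi)]
      rfl

theorem blkOf_flatMap_add {α : Type*} (f : α → ℕ) (l : List α) (R : List Sym) (i : ℕ) :
    blkOf (l.flatMap (fun a => encodeNat (f a)) ++ R) (l.length + i) = blkOf R i := by
  induction l with
  | nil => simp
  | cons a l ih =>
    rw [List.flatMap_cons, List.append_assoc, List.length_cons, add_right_comm,
      blkOf_encodeNat_succ, ih]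

theorem count_flatMap {α : Type*} (f : α → ℕ) (l : List α) :
    (l.flatMap (fun a => encodeNat (f a))).count (some false) = l.length := by
  induction l with
  | nil => simp
  | cons a l ih =>
    rw [List.flatMap_cons, List.count_append, ih]
    simp [encodeNat, List.count_replicate, add_comm]

variable (I : SPRInstance)

/-- The part of the word after the matrix. -/
def tailWord : List Sym :=
  encodeNat I.s ++ (encodeNat I.t ++ (I.P.1.support.flatMap (fun v => encodeNat v.val) ++
    (none :: (I.Q.1.support.flatMap (fun v => encodeNat v.val) ++ [none]))))

theorem encode_eq : I.encode = (encodeNat I.n ++ encodeGraph I.G) ++ tailWord I := by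
  simp [encode, encodePath, tailWord]

theorem num_encode : num I.encode = I.n := by
  rw [encode_eq, List.append_assoc, num_encodeNat]

/-- The number `n` takes `n + 1` symbols, and each of the `n` rows takes `n + 1` with its separator.
-/
theorem base_encode : base I.encode = (encodeNat I.n ++ encodeGraph I.G).length := by
  rw [base, num_encode, List.length_append, length_encodeNat, length_encodeGraph]
  ring

theorem wAdj_encode (u v : Fin I.n) : WAdj I.encode u v ↔ I.G.Adj u v := by
  have hlt : u.val * (I.n + 1) + v.val < (encodeGraph I.G).length := by
    have h₁ : (u.val + 1) * (I.n + 1) ≤ I.n * (I.n + 1) := Nat.mul_le_mul_right _ u.2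
    have := v.2
    rw [length_encodeGraph]
    nlinarith
  rw [WAdj, num_encode, encode_eq, List.append_assoc,
    List.getElem?_append_right (by rw [length_encodeNat]; omega), length_encodeNat,
    Nat.add_sub_cancel_left, List.getElem?_append_left hlt, getElem?_encodeGraph]
  simp

theorem length_support_P : I.P.1.support.length = I.G.dist I.s I.t + 1 := by
  rw [SimpleGraph.Walk.length_support, I.P.2]

theorem length_support_Q : I.Q.1.support.length = I.G.dist I.s I.t + 1 := by
  rw [SimpleGraph.Walk.length_support, I.Q.2]

theorem blk_encode (i : ℕ) : blk I.encode i = blkOf (tailWord I) i := by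
  have := base_encode I
  rw [encode_eq] at this ⊢
  exact blk_append this i

/-- Each block ends in one zero: there is one block each for `s` and `t`, and one for each of the `d
+ 1` vertices of either path. -/
theorem zeros_encode : zeros I.encode = 2 * I.G.dist I.s I.t + 4 := by
  have := base_encode I
  rw [encode_eq] at this ⊢
  rw [zeros_append this]
  simp only [tailWord, List.count_append, List.count_cons, count_flatMap (fun v : Fin I.n => v.val),
    length_support_P, length_support_Q]
  simp [encodeNat, List.count_replicate]
  omega

theorem len_encode : len I.encode = I.G.dist I.s I.t := by
  rw [len, zeros_encode]
  have : ∀ x, 2 * x + 4 < 2 * I.G.dist I.s I.t + 4 ↔ x < I.G.dist I.s I.t := by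
    intro x
    omega
  simp only [this]
  exact sum_ite_lt (by omega)

theorem blk_zero_encode : blk I.encode 0 = I.s := by
  rw [blk_encode, tailWord, blkOf_encodeNat_zero]

theorem blk_one_encode : blk I.encode 1 = I.t := by
  rw [blk_encode, tailWord, blkOf_encodeNat_succ, blkOf_encodeNat_zero]

theorem getVert_min {V : Type*} {G : SimpleGraph V} {s t : V} (P : ShortestPath G s t) (i : ℕ) :
    P.1.getVert (i - (i - G.dist s t)) = P.1.getVert i := by
  rcases le_total i (G.dist s t) with h | h
  · congr 1
    omega
  · rw [(ShortestPath.isSeq P).eq_end i h, (ShortestPath.isSeq P).eq_end _ (by omega)]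

/-- The expression `i - (i - d)` is the minimum of `i` and `d`, so positions past the end read `t`;
the shift by two skips the blocks of `s` and `t`. -/
theorem pvert_encode (i : ℕ) : pvert I.encode i = I.P.1.getVert i := by
  have hi : i - (i - I.G.dist I.s I.t) < I.P.1.support.length := by
    rw [length_support_P]
    omega
  rw [pvert, len_encode, blk_encode, tailWord, blkOf_encodeNat_succ, blkOf_encodeNat_succ,
    blkOf_flatMap _ _ _ hi, ← getVert_min I.P i, SimpleGraph.Walk.getVert_eq_support_getElem]
  have := I.P.2
  omega

theorem qvert_encode (i : ℕ) : qvert I.encode i = I.Q.1.getVert i := by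
  have hi : i - (i - I.G.dist I.s I.t) < I.Q.1.support.length := by
    rw [length_support_Q]
    omega
  rw [qvert, len_encode, blk_encode, tailWord,
    show i - (i - I.G.dist I.s I.t) + (I.G.dist I.s I.t + 3) =
      (I.P.1.support.length + (i - (i - I.G.dist I.s I.t))) + 1 + 1 by
        rw [length_support_P]; omega,
    blkOf_encodeNat_succ, blkOf_encodeNat_succ, blkOf_flatMap_add, blkOf_none,
    blkOf_flatMap _ _ _ hi, ← getVert_min I.Q i, SimpleGraph.Walk.getVert_eq_support_getElem]
  have := I.Q.2
  omega

open StackProgram Ctx SPRInstance SPRCombinatorics Relation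

/-! ### Reachability by iteration -/

/-- The elements that are found in `k` rounds of the search from `p`. -/
def Found {X : Type*} (p : X) (v : X → Prop) (r : X → X → Prop) : ℕ → Set X
  | 0 => ∅
  | k + 1 => {x | v x ∧ (x = p ∨ ∃ y ∈ Found p v r k, r y x)}

section Found

variable {X : Type*} {p : X} {v : X → Prop} {r : X → X → Prop}

theorem found_subset_succ (k : ℕ) : Found p v r k ⊆ Found p v r (k + 1) := by
  induction k with
  | zero => exact Set.empty_subset _
  | succ k ih =>
    rintro x ⟨hv, hx⟩
    exact ⟨hv, hx.imp_right fun ⟨y, hy, h⟩ => ⟨y, ih hy, h⟩⟩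

/-- Otherwise the increasing chain would grow strictly `card X + 1` times and outgrow `X`. -/
theorem exists_found_eq_succ [Fintype X] :
    ∃ k ≤ Fintype.card X, Found p v r (k + 1) = Found p v r k := by
  by_contra! h
  have key : ∀ k ≤ Fintype.card X + 1, k ≤ (Found p v r k).ncard := by
    intro k
    induction k with
    | zero => exact fun _ => Nat.zero_le _
    | succ k ih =>
      intro hk
      have h₁ := ih (by omega)
      have h₂ := Set.ncard_lt_ncard ((found_subset_succ (p := p) (v := v) (r := r) k).ssubset_of_ne
        (h k (by omega)).symm) (Set.toFinite _)
      omega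
  have h₁ := key _ le_rfl
  have h₂ := Set.ncard_le_card (Found p v r (Fintype.card X + 1))
  rw [Nat.card_eq_fintype_card] at h₂
  omega

/-- As soon as two consecutive rounds agree, the set found contains `p` and is closed under search
steps. The extra round is harmless by monotonicity. -/
theorem mem_found_iff [Fintype X] (hp : v p) (x : X) :
    x ∈ Found p v r (Fintype.card X + 1) ↔ ReflTransGen (fun y x => r y x ∧ v x) p x := by
  constructor
  · generalize Fintype.card X + 1 = k
    intro h
    induction k generalizing x with
    | zero => exact h.elim
    | succ k ih =>
      obtain ⟨hv, rfl | ⟨y, hy, hyx⟩⟩ := h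
      · exact .refl
      · exact (ih y hy).tail ⟨hyx, hv⟩
  · obtain ⟨k, hk, heq⟩ := exists_found_eq_succ (p := p) (v := v) (r := r)
    have hmono : Monotone (Found p v r) := monotone_nat_of_le_succ found_subset_succ
    have hfix : ∀ x, ReflTransGen (fun y x => r y x ∧ v x) p x → x ∈ Found p v r k := by
      intro x h
      induction h with
      | refl =>
        rw [← heq]
        exact ⟨hp, Or.inl rfl⟩
      | tail _ h ih =>
        rw [← heq]
        exact ⟨h.2, Or.inr ⟨_, ih, h.1⟩⟩
    exact fun h => hmono (by omega) (hfix x h)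

end Found

/-! ### Paths of length at most four -/

variable {V : Type*} {G : SimpleGraph V} {s t : V}

/-- The sequence with the vertices `x` at the positions one to three. -/
def tripleSeq (s t : V) (x : V × V × V) : ℕ → V
  | 0 => s
  | 1 => x.1
  | 2 => x.2.1
  | 3 => x.2.2
  | _ => t

/-- The vertices of a path at the positions one to three. -/
def triple (P : ShortestPath G s t) : V × V × V :=
  (P.1.getVert 1, P.1.getVert 2, P.1.getVert 3)

/-- Two triples differ in at most one position. -/
def Differ (x y : V × V × V) : Prop :=
  (x.2.1 = y.2.1 ∧ x.2.2 = y.2.2) ∨ (x.1 = y.1 ∧ x.2.2 = y.2.2) ∨ (x.1 = y.1 ∧ x.2.1 = y.2.1)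

/-- Position zero is `s`, and from position four on the sequence is constantly `t`, so only three
positions are free. -/
theorem getVert_eq_tripleSeq (hd : G.dist s t ≤ 4) (P : ShortestPath G s t) :
    P.1.getVert = tripleSeq s t (triple P) := by
  funext i
  rcases i with _ | _ | _ | _ | i
  · exact P.1.getVert_zero
  · rfl
  · rfl
  · rfl
  · exact (ShortestPath.isSeq P).eq_end _ (by omega)

theorem differ_of_step {P Q : ShortestPath G s t} (h : ReconfStep P Q) :
    Differ (triple P) (triple Q) := by
  obtain ⟨j, -, hj⟩ := h
  have heq : ∀ k, k ≠ j → P.1.getVert k = Q.1.getVert k := fun k hk =>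
    not_not.1 fun h => hk (hj k h)
  by_cases h₁ : j = 1
  · exact Or.inl ⟨heq 2 (by omega), heq 3 (by omega)⟩
  by_cases h₂ : j = 2
  · exact Or.inr (Or.inl ⟨heq 1 (by omega), heq 3 (by omega)⟩)
  · exact Or.inr (Or.inr ⟨heq 1 (by omega), heq 2 (by omega)⟩)

theorem step_of_differ {P Q : ShortestPath G s t} (hd : G.dist s t ≤ 4)
    (h : Differ (triple P) (triple Q)) (hne : triple P ≠ triple Q) : ReconfStep P Q := by
  rw [ReconfStep, getVert_eq_tripleSeq hd P, getVert_eq_tripleSeq hd Q]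
  generalize triple P = x at *
  generalize triple Q = y at *
  obtain ⟨a, b, c⟩ := x
  obtain ⟨a', b', c'⟩ := y
  rcases h with ⟨h₁, h₂⟩ | ⟨h₁, h₂⟩ | ⟨h₁, h₂⟩ <;> dsimp only at h₁ h₂ <;> subst h₁ h₂
  · refine ⟨1, fun h => hne (by simpa [tripleSeq] using h), fun i hi => ?_⟩
    rcases i with _ | _ | _ | _ | i <;> first | rfl | exact absurd rfl hi
  · refine ⟨2, fun h => hne (by simpa [tripleSeq] using h), fun i hi => ?_⟩
    rcases i with _ | _ | _ | _ | i <;> first | rfl | exact absurd rfl hi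
  · refine ⟨3, fun h => hne (by simpa [tripleSeq] using h), fun i hi => ?_⟩
    rcases i with _ | _ | _ | _ | i <;> first | rfl | exact absurd rfl hi

theorem reconfigurable_iff_triple (hd : G.dist s t ≤ 4) {P Q : ShortestPath G s t} :
    Reconfigurable P Q ↔ ReflTransGen (fun y x => Differ y x ∧
      IsSeq G s t (G.dist s t) (tripleSeq s t x)) (triple P) (triple Q) := by
  constructor
  · intro h
    induction h with
    | refl => exact .refl
    | @tail Q R _ h ih =>
      refine ih.tail ⟨differ_of_step h, ?_⟩
      rw [← getVert_eq_tripleSeq hd]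
      exact ShortestPath.isSeq R
  · intro h
    have key : ∀ x, ReflTransGen (fun y x => Differ y x ∧
        IsSeq G s t (G.dist s t) (tripleSeq s t x)) (triple P) x →
        ∃ R : ShortestPath G s t, triple R = x ∧ Reconfigurable P R := by
      intro x h
      induction h with
      | refl => exact ⟨P, rfl, .refl⟩
      | @tail y x _ h ih =>
        obtain ⟨R, rfl, hR⟩ := ih
        obtain ⟨R', hR'⟩ := h.2.exists_shortestPath
        have hx : triple R' = x := by
          rw [triple, hR']
          rfl
        subst hx
        -- `Differ` is reflexive, so the search may stay in place; such a move is dropped.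
        by_cases hne : triple R = triple R'
        · exact ⟨R, hne, hR⟩
        · exact ⟨R', rfl, hR.tail (step_of_differ hd h.1 hne)⟩
    obtain ⟨R, hR, hPR⟩ := key _ h
    have : R = Q := ShortestPath.ext (by
      rw [getVert_eq_tripleSeq hd R, getVert_eq_tripleSeq hd Q, hR])
    exact this ▸ hPR

/-! ### Correctness of the answer -/

theorem code_lt {n a b c : ℕ} (ha : a < n) (hb : b < n) (hc : c < n) :
    code n a b c < n * n * n := by
  have h₁ : (a + 1) * n ≤ n * n := Nat.mul_le_mul_right _ ha
  have h₂ : (a * n + b + 1) * n ≤ n * n * n := Nat.mul_le_mul_right _ (by nlinarith)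
  rw [code]
  nlinarith

theorem mul_add_inj {n a b a' b' : ℕ} (hb : b < n) (hb' : b' < n) (h : a * n + b = a' * n + b') :
    a = a' ∧ b = b' := by
  have h₁ := congrArg (· / n) h
  have h₂ := congrArg (· % n) h
  have hn : 0 < n := by omega
  simp only [mul_comm _ n, Nat.mul_add_div hn, Nat.div_eq_of_lt hb, Nat.div_eq_of_lt hb',
    Nat.mul_add_mod, Nat.mod_eq_of_lt hb, Nat.mod_eq_of_lt hb', add_zero] at h₁ h₂
  exact ⟨h₁, h₂⟩

theorem code_inj {n a b c a' b' c' : ℕ} (hb : b < n) (hb' : b' < n) (hc : c < n) (hc' : c' < n)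
    (h : code n a b c = code n a' b' c') : a = a' ∧ b = b' ∧ c = c' := by
  obtain ⟨h₁, h₂⟩ := mul_add_inj hc hc' h
  obtain ⟨h₃, h₄⟩ := mul_add_inj hb hb' h₁
  exact ⟨h₃, h₄, h₂⟩

variable (I : SPRInstance)

theorem step_encode (i : ℕ) (u v : Fin I.n) : Step I.encode i u v ↔
    (i < I.G.dist I.s I.t ∧ I.G.Adj u v) ∨ (I.G.dist I.s I.t ≤ i ∧ u = I.t ∧ v = I.t) := by
  rw [Step, len_encode, wAdj_encode, blk_one_encode, Fin.val_inj, Fin.val_inj]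

/-- For paths shorter than four, the second alternative of `Step` forces the unused positions to be
filled with `t`. -/
theorem valid_encode (hd : I.G.dist I.s I.t ≤ 4) (x : Fin I.n × Fin I.n × Fin I.n) :
    Valid I.encode x.1 x.2.1 x.2.2 ↔
      IsSeq I.G I.s I.t (I.G.dist I.s I.t) (tripleSeq I.s I.t x) := by
  rw [Valid, blk_zero_encode, blk_one_encode, step_encode, step_encode, step_encode, step_encode]
  constructor
  · rintro ⟨h₀, h₁, h₂, h₃⟩
    refine ⟨rfl, fun i hi => ?_, fun i hi => ?_⟩
    · rcases i with _ | _ | _ | _ | i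
      · exact (h₀.resolve_right fun h => by omega).2
      · exact (h₁.resolve_right fun h => by omega).2
      · exact (h₂.resolve_right fun h => by omega).2
      · exact (h₃.resolve_right fun h => by omega).2
      · omega
    · rcases i with _ | _ | _ | _ | i
      · exact (h₀.resolve_left fun h => by omega).2.1
      · exact (h₁.resolve_left fun h => by omega).2.1
      · exact (h₂.resolve_left fun h => by omega).2.1
      · exact (h₃.resolve_left fun h => by omega).2.1
      · rfl
  · intro h
    have key : ∀ i, (i < I.G.dist I.s I.t ∧ I.G.Adj (tripleSeq I.s I.t x i)
        (tripleSeq I.s I.t x (i + 1))) ∨ (I.G.dist I.s I.t ≤ i ∧ tripleSeq I.s I.t x i = I.t ∧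
          tripleSeq I.s I.t x (i + 1) = I.t) := by
      intro i
      rcases Nat.lt_or_ge i (I.G.dist I.s I.t) with hi | hi
      · exact Or.inl ⟨hi, h.adj i hi⟩
      · exact Or.inr ⟨hi, h.eq_end i hi, h.eq_end (i + 1) (by omega)⟩
    exact ⟨key 0, key 1, key 2, key 3⟩

theorem nextTab_eq_iff {size : List Sym → ℕ} {P : Base × ℕ → Prop} {w T : List Sym} {x : ℕ}
    (hx : x < size w) : (nextTab size P w T)[x]? = some (some true) ↔ P ((w, T), x) := by
  simp [nextTab, hx]

theorem near_encode {T : List Sym} {F : Set (Fin I.n × Fin I.n × Fin I.n)}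
    (hT : ∀ y : Fin I.n × Fin I.n × Fin I.n,
      T[code I.n y.1 y.2.1 y.2.2]? = some (some true) ↔ y ∈ F)
    (x : Fin I.n × Fin I.n × Fin I.n) :
    Near I.encode T x.1 x.2.1 x.2.2 ↔ x = triple I.P ∨ ∃ y ∈ F, Differ y x := by
  obtain ⟨a, b, c⟩ := x
  rw [Near, num_encode, pvert_encode, pvert_encode, pvert_encode, Fin.val_inj, Fin.val_inj,
    Fin.val_inj]
  refine or_congr ?_ ?_
  · simp [triple, Prod.ext_iff]
  · constructor
    · rintro ⟨y, hy, h | h | h⟩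
      · exact ⟨(⟨y, hy⟩, b, c), (hT _).1 h, Or.inl ⟨rfl, rfl⟩⟩
      · exact ⟨(a, ⟨y, hy⟩, c), (hT _).1 h, Or.inr (Or.inl ⟨rfl, rfl⟩)⟩
      · exact ⟨(a, b, ⟨y, hy⟩), (hT _).1 h, Or.inr (Or.inr ⟨rfl, rfl⟩)⟩
    · rintro ⟨⟨a', b', c'⟩, hF, h⟩
      have := (hT _).2 hF
      rcases h with ⟨h₁, h₂⟩ | ⟨h₁, h₂⟩ | ⟨h₁, h₂⟩ <;> dsimp only at h₁ h₂ <;> subst h₁ h₂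
      · exact ⟨a', a'.2, Or.inl this⟩
      · exact ⟨b', b'.2, Or.inr (Or.inl this)⟩
      · exact ⟨c', c'.2, Or.inr (Or.inr this)⟩

/-- The number of codes of triples. -/
def size (w : List Sym) : ℕ := num w * num w * num w

/-- The table after `k` rounds is the characteristic function of the `k`-th search set; injectivity
of the codes lets an entry determine its triple. -/
theorem table_encode (hd : I.G.dist I.s I.t ≤ 4) (k : ℕ) (x : Fin I.n × Fin I.n × Fin I.n) :
    ((nextTab size Entry I.encode)^[k] [])[code I.n x.1 x.2.1 x.2.2]? = some (some true) ↔
      x ∈ Found (triple I.P)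
        (fun x => IsSeq I.G I.s I.t (I.G.dist I.s I.t) (tripleSeq I.s I.t x)) Differ k := by
  induction k generalizing x with
  | zero => simp [Found]
  | succ k ih =>
    rw [Function.iterate_succ_apply', nextTab_eq_iff
      (by rw [size, num_encode]; exact code_lt x.1.2 x.2.1.2 x.2.2.2)]
    simp only [Found, Set.mem_ofPred_eq]
    rw [← near_encode I ih x, ← valid_encode I hd x, Entry]
    constructor
    · rintro ⟨a, ha, b, hb, c, hc, h, hv, hn⟩
      dsimp only at *
      rw [num_encode] at *
      obtain ⟨rfl, rfl, rfl⟩ := code_inj x.2.1.2 hb x.2.2.2 hc h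
      exact ⟨hv, hn⟩
    · rintro ⟨hv, hn⟩
      refine ⟨x.1, ?_, x.2.1, ?_, x.2.2, ?_, ?_, hv, hn⟩
      · rw [num_encode]; exact x.1.2
      · rw [num_encode]; exact x.2.1.2
      · rw [num_encode]; exact x.2.2.2
      · rw [num_encode]

/-- The round count is the number of triples plus one, as `mem_found_iff` requires. The circular-arc
hypothesis enters only for distance at least five. -/
theorem answer_encode (hG : IsCircularArcGraph I.G) :
    I.IsYes ↔ Answer (I.encode, (nextTab size Entry I.encode)^[size I.encode + 1] []) := by
  rw [IsYes, Answer]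
  dsimp only
  rw [len_encode, num_encode, qvert_encode, qvert_encode, qvert_encode]
  rcases Nat.lt_or_ge (I.G.dist I.s I.t) 5 with hd | hd
  · have hd' : I.G.dist I.s I.t ≤ 4 := by omega
    have hcard : size I.encode = Fintype.card (Fin I.n × Fin I.n × Fin I.n) := by
      simp [size, num_encode, mul_assoc]
    have htab := table_encode I hd' (size I.encode + 1) (triple I.Q)
    rw [hcard, mem_found_iff (by rw [← getVert_eq_tripleSeq hd']; exact ShortestPath.isSeq I.P),
      ← reconfigurable_iff_triple hd'] at htab
    rw [← htab, hcard]
    constructor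
    · exact fun h => Or.inr ⟨hd', h⟩
    · rintro (h | h)
      · omega
      · exact h.2
  · rw [reconfigurable_iff_meets hG hd]
    have : ∀ i, Meets I.G (I.P.1.getVert i) (I.Q.1.getVert i) ↔
        pvert I.encode i = qvert I.encode i ∨ WAdj I.encode (pvert I.encode i)
          (qvert I.encode i) := by
      intro i
      rw [pvert_encode, qvert_encode, wAdj_encode, Fin.val_inj]
      rfl
    simp only [this]
    constructor
    · exact fun h => Or.inl ⟨hd, h⟩
    · rintro (h | h)
      · exact h.2
      · omega

theorem comp_size {γ : Type} [Ctx γ] : Comp (fun g : γ => size (word g)) :=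
  (comp_num.mul comp_num).mul comp_num

end SPRWord

theorem mainTheorem7 : SPRPolyTimeOn (fun _ G => IsCircularArcGraph G) :=
  StackProgram.polyTime_of_comp (size := SPRWord.size) (rounds := fun w => SPRWord.size w + 1)
    (SPRWord.comp_size (γ := StackProgram.Base))
    ((SPRWord.comp_size (γ := StackProgram.Base)).add StackProgram.Comp.one)
    SPRWord.compP_entry SPRWord.compP_answer
    fun I => (@decide_eq_true_iff _ (Classical.propDecidable _)).trans
      (SPRWord.answer_encode I.1 I.2)
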